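/- **Definitions.** Rows of an $n\times n$ grid are numbered $1,\dots,n$ from top to bottom and columns from left to right. A permutation $\pi\in S_n$ is *Grassmannian* if it has at most one descent. A *bumpless pipe dream* (BPD) of size $n$ is a tiling of the $n\times n$ grid by the six tiles cross, blank, horizontal, vertical, r-elbow (joining the south and east edges) and j-elbow (joining the west and north edges) which forms $n$ pipes travelling from the south border to the east border. Label the pipes $1,\dots,n$ from left to right on the south border, ignore every crossing of two pipes after their first one, and read the labels from top to bottom on the east border; this is the permutation of the BPD. $\mathrm{BPD}(\pi)$ is the set of all BPDs (reduced or not) with permutation $\pi$. The *Rothe BPD* of $\pi$ is the one whose r-elbows are at the positions $(i,\pi(i))$ and which has no j-elbows. A *simple droop* takes a $2\times2$ square with an r-elbow in its north-west cell and a blank tile in its south-east cell and reroutes the pipe through the south-east cell, so that the north-west cell becomes blank. $\mathrm{droop}(\pi)$ is the poset of all BPDs obtained from the Rothe BPD of $\pi$ by sequences of simple droops, where each simple droop moves up. A *pipe dream* of size $n$ is a tiling of the $n\times n$ grid by crosses and elbows (an elbow joins north with west and east with south), with all crosses strictly above the main antidiagonal. Its $n$ pipes are labelled $1,\dots,n$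 on the north border, and its permutation is read from top to bottom on the west border. It is *reduced* if no two pipes cross twice. $\mathrm{PD}^{red}(\pi)$ is the set of reduced pipe dreams with permutation $\pi$. The *bottom pipe dream* of $\pi$ has its crosses left-justified, with $\#\{k>i:\pi(k)<\pi(i)\}$ crosses in row $i$. A *simple slide* takes a $2\times 2$ square whose only cross is in the south-west cell and moves this cross to the north-east cell. $\mathrm{slide}(\pi)$ is the poset of all pipe dreams obtained from the bottom pipe dream of $\pi$ by sequences of simple slides, where each simple slide moves up, and $\mathrm{slide}(\pi)^*$ is its dual. **Theorem.** Let $\pi\in S_n$ be Grassmannian. Then $\mathrm{droop}(\pi)$ and $\mathrm{slide}(\pi)$ have underlying sets $\mathrm{BPD}(\pi)$ and $\mathrm{PD}^{red}(\pi)$, respectively, and there is a bijection $\Phi:\mathrm{BPD}(\pi)\to\mathrm{PD}^{red}(\pi)$ such that: 1. $\Phi$ is an isomorphism of posets $\mathrm{droop}(\pi)\cong\mathrm{slide}(\pi)^*$; 2. $\Phi$ maps the Rothe BPD of $\pi$ to the top pipe dream of $\pi$, that is, to the unique element of $\mathrm{PD}^{red}(\pi)$ in which all crosses are top-justified in their columns;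 3. $\Phi$ is explicit and reverses the row weights: let $d$ be the position of the descent of $\pi$ (an arbitrary positive integer if $\pi$ is the identity). For every $D\in\mathrm{BPD}(\pi)$, all blank tiles of $D$ and all crosses of $\Phi(D)$ lie in rows $1,\dots,d$, and $\Phi(D)$ has a cross at $(d+1-i,j)$ if and only if $D$ has a blank tile at $(i,j)$. In particular, the number of blank tiles of $D$ in row $i$ equals the number of crosses of $\Phi(D)$ in row $d+1-i$. -/

import Mathlib

open Relation

/-! Rows and columns of an `n × n` grid are indexed by `Fin n`, rows from top to bottom and columns
from left to right. The cell in row `i` and column `j` has top-left corner `(i, j)`. -/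

/-- There is a descent of `π` at the (zero-based) position `i`. -/
def IsDescent {n : ℕ} (π : Equiv.Perm (Fin n)) (i : ℕ) : Prop :=
  ∃ h : i + 1 < n, π ⟨i + 1, h⟩ < π ⟨i, Nat.lt_of_succ_lt h⟩

/-- A permutation is Grassmannian if it has at most one descent. -/
def IsGrassmannian {n : ℕ} (π : Equiv.Perm (Fin n)) : Prop :=
  ∀ i j : ℕ, IsDescent π i → IsDescent π j → i = j

/-- The six tiles of a bumpless pipe dream. `rElbow` joins the south and the east edge of its cell,
`jElbow` joins the west and the north edge. -/
inductive Tile : Type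
  | cross | blank | horizontal | vertical | rElbow | jElbow
  deriving DecidableEq

namespace Tile

/-- A pipe meets the north edge of the tile. -/
def north : Tile → Bool
  | cross | vertical | jElbow => true
  | _ => false

/-- A pipe meets the south edge of the tile. -/
def south : Tile → Bool
  | cross | vertical | rElbow => true
  | _ => false

/-- A pipe meets the east edge of the tile. -/
def east : Tile → Bool
  | cross | horizontal | rElbow => true
  | _ => false

/-- A pipe meets the west edge of the tile. -/
def west : Tile → Bool
  | cross | horizontal | jElbow => true
  | _ => false

end Tile

/-- A bumpless pipe dream of size `n`: the tiles fit together and form `n` pipes, which start at the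
`n` edges of the south border and end at the `n` edges of the east border. -/
@[ext]
structure BPD (n : ℕ) where
  tile : Fin n → Fin n → Tile
  vert : ∀ i i' j : Fin n, (i' : ℕ) = i + 1 → (tile i j).south = (tile i' j).north
  horiz : ∀ i j j' : Fin n, (j' : ℕ) = j + 1 → (tile i j).east = (tile i j').west
  northBorder : ∀ i j : Fin n, (i : ℕ) = 0 → (tile i j).north = false
  southBorder : ∀ i j : Fin n, (i : ℕ) + 1 = n → (tile i j).south = true
  westBorder : ∀ i j : Fin n, (j : ℕ) = 0 → (tile i j).west = false
  eastBorder : ∀ i j : Fin n, (j : ℕ) + 1 = n → (tile i j).east = true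

namespace BPD

/-- The set of positions of the blank tiles. -/
def blanks {n : ℕ} (D : BPD n) : Finset (Fin n × Fin n) :=
  Finset.univ.filter fun p => D.tile p.1 p.2 = Tile.blank

/-- The number of blank tiles in row `i`, that is, the exponent of `x_i` in the weight of `D`. -/
def rowWeight {n : ℕ} (D : BPD n) (i : Fin n) : ℕ :=
  (D.blanks.filter fun p => p.1 = i).card

/-- `D` has permutation `π`. Here `v i j` and `h i j` are the labels of the pipes on the top edge
and on the left edge of the cell `(i, j)` (labels of edges that no pipe meets are irrelevant). The
pipes are labelled from left to right on the south border, they are followed to the north and to the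
east, and the labels are read from top to bottom on the east border.

At a cross tile the two pipes cross if they have not crossed before, that is, if the label coming from
the west is smaller than the label coming from the south; all later crossings of the same two pipes
are ignored. In both cases the larger label leaves to the north and the smaller one to the east. For
a reduced bumpless pipe dream no crossing is ignored; in general the permutation obtained is the
Demazure product of the crossings. -/
def HasPerm {n : ℕ} (D : BPD n) (π : Equiv.Perm (Fin n)) : Prop :=
  ∃ v h : ℕ → ℕ → ℕ,
    (∀ j : Fin n, v n j = j) ∧
    (∀ i j : Fin n,
      match D.tile i j with
      | Tile.cross => v i j = max (v (i + 1) j) (h i j) ∧ h i (j + 1) = min (v (i + 1) j) (h i j)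
      | Tile.blank => True
      | Tile.horizontal => h i (j + 1) = h i j
      | Tile.vertical => v i j = v (i + 1) j
      | Tile.rElbow => h i (j + 1) = v (i + 1) j
      | Tile.jElbow => v i j = h i j) ∧
    (∀ i : Fin n, h i n = π i)

/-- A simple droop: inside the `2 × 2` square with rows `i, i'` and columns `j, j'`, a pipe that
turns at the north-west cell, opposite to a blank tile, is rerouted through the south-east cell. -/
def SimpleDroop {n : ℕ} (D D' : BPD n) : Prop :=
  ∃ i i' j j' : Fin n, (i' : ℕ) = i + 1 ∧ (j' : ℕ) = j + 1 ∧
    D.tile i j = Tile.rElbow ∧ D'.tile i j = Tile.blank ∧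
    D.tile i' j' = Tile.blank ∧ D'.tile i' j' = Tile.jElbow ∧
    (D.tile i' j = Tile.vertical ∧ D'.tile i' j = Tile.rElbow ∨
      D.tile i' j = Tile.jElbow ∧ D'.tile i' j = Tile.horizontal) ∧
    (D.tile i j' = Tile.horizontal ∧ D'.tile i j' = Tile.rElbow ∨
      D.tile i j' = Tile.jElbow ∧ D'.tile i j' = Tile.vertical) ∧
    ∀ a b : Fin n, ¬ ((a = i ∨ a = i') ∧ (b = j ∨ b = j')) → D'.tile a b = D.tile a b

/-- The Rothe bumpless pipe dream of `π`: the pipe turning at `(i, π i)` runs straight to the south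
and straight to the east. -/
def rothe {n : ℕ} (π : Equiv.Perm (Fin n)) : BPD n where
  tile i j :=
    if j = π i then Tile.rElbow
    else if π i < j then (if π.symm j < i then Tile.cross else Tile.horizontal)
    else (if π.symm j < i then Tile.vertical else Tile.blank)
  vert i i' j hi := by
    have h1 : j = π i ↔ π.symm j = i := by rw [Equiv.symm_apply_eq]
    have h2 : j = π i' ↔ π.symm j = i' := by rw [Equiv.symm_apply_eq]
    simp only [h1, h2]
    split_ifs <;> simp only [Tile.south, Tile.north] <;> omega
  horiz i j j' hj := by
    have h1 : j = π i ↔ π.symm j = i := by rw [Equiv.symm_apply_eq]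
    have h2 : j' = π i ↔ π.symm j' = i := by rw [Equiv.symm_apply_eq]
    split_ifs <;> simp only [Tile.east, Tile.west] <;> omega
  northBorder i j hi := by
    split_ifs <;> simp only [Tile.north] <;> omega
  southBorder i j hi := by
    have h1 : j = π i ↔ π.symm j = i := by rw [Equiv.symm_apply_eq]
    simp only [h1]
    split_ifs <;> simp only [Tile.south] <;> omega
  westBorder i j hj := by
    split_ifs <;> simp only [Tile.west] <;> omega
  eastBorder i j hj := by
    split_ifs <;> simp only [Tile.east] <;> omega

theorem SimpleDroop.sum_lt {n : ℕ} {D D' : BPD n} (h : SimpleDroop D D') :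
    ∑ p ∈ D'.blanks, (p.1 : ℕ) < ∑ p ∈ D.blanks, (p.1 : ℕ) := by
  obtain ⟨i, i', j, j', hi, hj, h1, h2, h3, h4, h5, h6, h7⟩ := h
  have hii : i ≠ i' := by rintro rfl; omega
  have hjj : j ≠ j' := by rintro rfl; omega
  have hmem : (i', j') ∈ D.blanks := by simp [blanks, h3]
  have hnot : (i, j) ∉ D.blanks.erase (i', j') := by simp [blanks, h1]
  have key : D'.blanks = insert (i, j) (D.blanks.erase (i', j')) := by
    ext ⟨a, b⟩
    simp only [blanks, Finset.mem_filter, Finset.mem_univ, true_and, Finset.mem_insert,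
      Finset.mem_erase, Prod.mk.injEq, ne_eq]
    by_cases hab : (a = i ∨ a = i') ∧ (b = j ∨ b = j')
    · obtain ⟨rfl | rfl, rfl | rfl⟩ := hab
      · simp [h2]
      · rcases h6 with h6 | h6 <;> simp [h6, hii, Ne.symm hjj]
      · rcases h5 with h5 | h5 <;> simp [h5, Ne.symm hii, hjj]
      · simp [h4, Ne.symm hii]
    · rw [h7 a b hab]
      have e1 : ¬ (a = i ∧ b = j) := fun h => hab ⟨Or.inl h.1, Or.inl h.2⟩
      have e2 : ¬ (a = i' ∧ b = j') := fun h => hab ⟨Or.inr h.1, Or.inr h.2⟩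
      simp [e1, e2]
  rw [key, Finset.sum_insert hnot, ← Finset.add_sum_erase _ _ hmem]
  simp only
  omega

end BPD

/-- `BPD(π)`: all bumpless pipe dreams (reduced or not) with permutation `π`. -/
def bpdSet {n : ℕ} (π : Equiv.Perm (Fin n)) : Set (BPD n) :=
  {D | D.HasPerm π}

/-- The elements of the poset `droop(π)`: the bumpless pipe dreams obtained from the Rothe bumpless
pipe dream of `π` by applying simple droops in all possible ways. -/
def droopSet {n : ℕ} (π : Equiv.Perm (Fin n)) : Set (BPD n) :=
  {D | ReflTransGen BPD.SimpleDroop (BPD.rothe π) D}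

/-- The type of elements of `droop(π)`. -/
def Droop {n : ℕ} (π : Equiv.Perm (Fin n)) : Type :=
  {D : BPD n // D ∈ droopSet π}

/-- In `droop(π)` each simple droop moves up. -/
instance {n : ℕ} (π : Equiv.Perm (Fin n)) : PartialOrder (Droop π) where
  le D E := ReflTransGen BPD.SimpleDroop D.1 E.1
  le_refl _ := ReflTransGen.refl
  le_trans _ _ _ h h' := h.trans h'
  le_antisymm D E h h' := by
    have mono : ∀ {A B : BPD n}, ReflTransGen BPD.SimpleDroop A B →
        ∑ p ∈ B.blanks, (p.1 : ℕ) ≤ ∑ p ∈ A.blanks, (p.1 : ℕ) := by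
      intro A B hAB
      induction hAB with
      | refl => exact le_rfl
      | tail _ hs ih => exact hs.sum_lt.le.trans ih
    rcases ReflTransGen.cases_head h with h0 | ⟨C, hs, hC⟩
    · exact Subtype.ext h0
    · have := hs.sum_lt
      have := mono hC
      have := mono h'
      omega

/-- A pipe dream of size `n`, given by the positions of its cross tiles, all of which lie strictly
above the main antidiagonal. All other tiles are elbow tiles. -/
@[ext]
structure PD (n : ℕ) where
  cross : Finset (Fin n × Fin n)
  above : ∀ p ∈ cross, (p.1 : ℕ) + p.2 + 1 < n

namespace PD

/-- The number of cross tiles in row `i`, that is, the exponent of `x_i` in the weight of `P`. -/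
def rowWeight {n : ℕ} (P : PD n) (i : Fin n) : ℕ :=
  (P.cross.filter fun p => p.1 = i).card

/-- `P` is reduced and has permutation `π`. Here `v i j` and `h i j` are the labels of the pipes on
the top edge and on the left edge of the cell `(i, j)`. The pipes are labelled from left to right on
the north border, and the labels are read from top to bottom on the west border. A cross tile joins
north with south and east with west, an elbow tile joins north with west and east with south. The
last condition says that no two pipes cross twice. (The strands that enter from the east border
stay weakly below the antidiagonal; their labels are irrelevant.) -/
def IsReducedWithPerm {n : ℕ} (P : PD n) (π : Equiv.Perm (Fin n)) : Prop :=
  ∃ v h : ℕ → ℕ → ℕ,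
    (∀ j : Fin n, v 0 j = j) ∧
    (∀ i j : Fin n,
      if (i, j) ∈ P.cross then v (i + 1) j = v i j ∧ h i j = h i (j + 1)
      else h i j = v i j ∧ v (i + 1) j = h i (j + 1)) ∧
    (∀ i : Fin n, h i 0 = π i) ∧
    (∀ p ∈ P.cross, ∀ q ∈ P.cross,
      s(v p.1 p.2, h p.1 (p.2 + 1)) = s(v q.1 q.2, h q.1 (q.2 + 1)) → p = q)

/-- A simple slide: inside a `2 × 2` square whose only cross tile is in the south-west cell, this
cross tile moves to the north-east cell. -/
def SimpleSlide {n : ℕ} (P P' : PD n) : Prop :=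
  ∃ i i' j j' : Fin n, (i' : ℕ) = i + 1 ∧ (j' : ℕ) = j + 1 ∧
    (i', j) ∈ P.cross ∧ (i, j) ∉ P.cross ∧ (i, j') ∉ P.cross ∧ (i', j') ∉ P.cross ∧
    P'.cross = insert (i, j') (P.cross.erase (i', j))

/-- The `i`-th entry of the Lehmer code of `π`. -/
def lehmer {n : ℕ} (π : Equiv.Perm (Fin n)) (i : Fin n) : ℕ :=
  (Finset.univ.filter fun k : Fin n => i < k ∧ π k < π i).card

theorem lehmer_lt {n : ℕ} (π : Equiv.Perm (Fin n)) (i : Fin n) : lehmer π i + i < n := by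
  have h : lehmer π i ≤ (Finset.Ioi i).card :=
    Finset.card_le_card fun k hk => by
      simp only [Finset.mem_filter, Finset.mem_univ, true_and] at hk
      simpa using hk.1
  rw [Fin.card_Ioi] at h
  have := i.2
  omega

/-- The bottom pipe dream of `π`: all crosses are left-justified, and the numbers of crosses in the
rows are the entries of the Lehmer code of `π`. -/
def bottom {n : ℕ} (π : Equiv.Perm (Fin n)) : PD n where
  cross := Finset.univ.filter fun p => (p.2 : ℕ) < lehmer π p.1
  above p hp := by
    have h := lehmer_lt π p.1
    simp only [Finset.mem_filter, Finset.mem_univ, true_and] at hp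
    omega

/-- All crosses of `P` are top-justified. -/
def IsTopJustified {n : ℕ} (P : PD n) : Prop :=
  ∀ i i' j : Fin n, i < i' → (i', j) ∈ P.cross → (i, j) ∈ P.cross

theorem SimpleSlide.sum_lt {n : ℕ} {P P' : PD n} (h : SimpleSlide P P') :
    ∑ p ∈ P'.cross, (p.1 : ℕ) < ∑ p ∈ P.cross, (p.1 : ℕ) := by
  obtain ⟨i, i', j, j', hi, hj, h1, h2, h3, h4, h5⟩ := h
  have hnot : (i, j') ∉ P.cross.erase (i', j) := fun h => h3 (Finset.mem_of_mem_erase h)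
  rw [h5, Finset.sum_insert hnot, ← Finset.add_sum_erase _ _ h1]
  simp only
  omega

end PD

/-- `PD^red(π)`: all reduced pipe dreams with permutation `π`. -/
def redPDSet {n : ℕ} (π : Equiv.Perm (Fin n)) : Set (PD n) :=
  {P | P.IsReducedWithPerm π}

/-- The elements of the poset `slide(π)`: the pipe dreams obtained from the bottom pipe dream of `π`
by applying simple slides in all possible ways. -/
def slideSet {n : ℕ} (π : Equiv.Perm (Fin n)) : Set (PD n) :=
  {P | ReflTransGen PD.SimpleSlide (PD.bottom π) P}

/-- The type of elements of `slide(π)`. -/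
def Slide {n : ℕ} (π : Equiv.Perm (Fin n)) : Type :=
  {P : PD n // P ∈ slideSet π}

/-- In `slide(π)` each simple slide moves up. -/
instance {n : ℕ} (π : Equiv.Perm (Fin n)) : PartialOrder (Slide π) where
  le P Q := ReflTransGen PD.SimpleSlide P.1 Q.1
  le_refl _ := ReflTransGen.refl
  le_trans _ _ _ h h' := h.trans h'
  le_antisymm P Q h h' := by
    have mono : ∀ {A B : PD n}, ReflTransGen PD.SimpleSlide A B →
        ∑ p ∈ B.cross, (p.1 : ℕ) ≤ ∑ p ∈ A.cross, (p.1 : ℕ) := by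
      intro A B hAB
      induction hAB with
      | refl => exact le_rfl
      | tail _ hs ih => exact hs.sum_lt.le.trans ih
    rcases ReflTransGen.cases_head h with h0 | ⟨C, hs, hC⟩
    · exact Subtype.ext h0
    · have := hs.sum_lt
      have := mono hC
      have := mono h'
      omega

/-! Let `π` be increasing on the positions `0, ..., d` and on the positions after `d`. Everything rests
on the description `BPD.IsSplit` of `BPD(π)`: a bumpless pipe dream has permutation `π` if and only
if its rows below row `d` are those of the Rothe bumpless pipe dream and its rows `0, ..., d`
contain no crossing. Indeed, a crossing always sends the larger label to the north, so a crossing in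
the upper rows would leave a descent among `π 0, ..., π d` (`BPD.HasPerm.upper_ne_cross`); and in a
lower row, where the exit labels increase from top to bottom, any j-elbow or blank tile would make
the exit label larger than the label that has to leave there (`BPD.HasPerm.lower_eq`). So the upper
rows are families of `d + 1` nonintersecting lattice paths (vertical edges and horizontal edges),
which are determined by their blank tiles.

The map is `BPD.reflect`: blank tiles become crosses, and the rows `0, ..., d` are reflected. Under
the reflection, the strands of the pipe dream labelled `π 0, ..., π d` are the vertical edges and
the missing horizontal edges of the bumpless pipe dream. Since pipes with labels of the same kind
must not cross, the labels on all edges can be read off from the paths: they are given by the number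
of paths to the left. Two pipes cross only once because the blank tiles on a diagonal are
distinguished by this number (`BPD.IsSplit.blank_diagonal`).
Conversely, in a reduced pipe dream every cross is an inversion of `π`
(`PD.IsLabelling.inversion_of_mem`), hence its horizontal strand is one of `π 0, ..., π d` and its
vertical strand is not. This makes the four remaining combinations at an elbow correspond to the
four tiles that are neither crosses nor blank (`PD.IsLabelling.bpdTile_edges`), and the reflection
is a bijection.

A simple droop moves a blank tile one step to the north-west, so it becomes an inverse simple slide.
If a split bumpless pipe dream is not the Rothe one, its topmost j-elbow can be removed by an
inverse droop. If no droop is possible, the blank tiles are left-justified, and a left-justified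
reduced pipe dream is determined by the Lehmer code (`PD.IsReducedWithPerm.eq_bottom`). So all
elements lie between the Rothe bumpless pipe dream and the one that corresponds to the bottom pipe
dream. A top-justified reflection leaves no room for an inverse droop, which singles out the Rothe
bumpless pipe dream. -/

/-! ### Edges of a bumpless pipe dream -/

namespace BPD

variable {n : ℕ}

/-- A pipe of `D` runs through the top edge of the cell `(i, j)`. For `i = n` these are the edges of
the south border. -/
def vEdge (D : BPD n) (i j : ℕ) : Bool :=
  if h : i < n ∧ j < n then (D.tile ⟨i, h.1⟩ ⟨j, h.2⟩).north else decide (n ≤ i)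

/-- A pipe of `D` runs through the left edge of the cell `(i, j)`. For `j = n` these are the edges of
the east border. -/
def hEdge (D : BPD n) (i j : ℕ) : Bool :=
  if h : i < n ∧ j < n then (D.tile ⟨i, h.1⟩ ⟨j, h.2⟩).west else decide (n ≤ j)

theorem vEdge_eq_north (D : BPD n) (i j : Fin n) : D.vEdge i j = (D.tile i j).north := by
  simp [vEdge]

theorem hEdge_eq_west (D : BPD n) (i j : Fin n) : D.hEdge i j = (D.tile i j).west := by
  simp [hEdge]

theorem vEdge_succ (D : BPD n) (i j : Fin n) : D.vEdge (i + 1) j = (D.tile i j).south := by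
  by_cases h : (i : ℕ) + 1 < n
  · rw [D.vert i ⟨i + 1, h⟩ j rfl, ← vEdge_eq_north]
  · rw [D.southBorder i j (by omega)]
    simp [vEdge, h]
    omega

theorem hEdge_succ (D : BPD n) (i j : Fin n) : D.hEdge i (j + 1) = (D.tile i j).east := by
  by_cases h : (j : ℕ) + 1 < n
  · rw [D.horiz i j ⟨j + 1, h⟩ rfl, ← hEdge_eq_west]
  · rw [D.eastBorder i j (by omega)]
    simp [hEdge, h]
    omega

theorem vEdge_zero (D : BPD n) {j : ℕ} (hj : j < n) : D.vEdge 0 j = false := by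
  have h : 0 < n := by omega
  have := D.northBorder ⟨0, h⟩ ⟨j, hj⟩ rfl
  rwa [← vEdge_eq_north] at this

theorem hEdge_zero (D : BPD n) {i : ℕ} (hi : i < n) : D.hEdge i 0 = false := by
  have h : 0 < n := by omega
  have := D.westBorder ⟨i, hi⟩ ⟨0, h⟩ rfl
  rwa [← hEdge_eq_west] at this

theorem vEdge_last (D : BPD n) (j : ℕ) : D.vEdge n j = true := by
  simp [vEdge]

theorem hEdge_last (D : BPD n) (i : ℕ) : D.hEdge i n = true := by
  simp [hEdge]

/-- The number of pipes that run through the top edges of the cells of row `i` in the columns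
`0, ..., j - 1`. -/
def numV (D : BPD n) (i j : ℕ) : ℕ :=
  Nat.count (fun c => D.vEdge i c = true) j

theorem numV_zero (D : BPD n) (i : ℕ) : D.numV i 0 = 0 := Nat.count_zero _

theorem numV_succ (D : BPD n) (i j : ℕ) :
    D.numV i (j + 1) = D.numV i j + (D.vEdge i j).toNat := by
  rw [numV, Nat.count_succ, numV]
  cases D.vEdge i j <;> simp

theorem numV_mono (D : BPD n) (i : ℕ) {j k : ℕ} (h : j ≤ k) : D.numV i j ≤ D.numV i k :=
  Nat.count_monotone _ h

theorem numV_le (D : BPD n) (i j : ℕ) : D.numV i j ≤ j :=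
  Nat.count_le _

/-- The pipes that enter the cells `(i, 0), ..., (i, j - 1)` from the south leave them to the north,
except for the one that runs through the left edge of `(i, j)`. -/
theorem numV_succ_left (D : BPD n) {i j : ℕ} (hi : i < n) (hj : j ≤ n) :
    D.numV (i + 1) j = D.numV i j + (D.hEdge i j).toNat := by
  induction j with
  | zero => simp [numV_zero, hEdge_zero D hi]
  | succ j ih =>
    rw [numV_succ, numV_succ, ih (by omega)]
    have h1 := D.vEdge_succ ⟨i, hi⟩ ⟨j, hj⟩
    have h2 := D.hEdge_succ ⟨i, hi⟩ ⟨j, hj⟩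
    have h3 := D.vEdge_eq_north ⟨i, hi⟩ ⟨j, hj⟩
    have h4 := D.hEdge_eq_west ⟨i, hi⟩ ⟨j, hj⟩
    simp only at h1 h2 h3 h4
    rw [h1, h2, h3, h4]
    cases D.tile ⟨i, hi⟩ ⟨j, hj⟩ <;>
      simp only [Tile.north, Tile.south, Tile.east, Tile.west, Bool.toNat_true,
        Bool.toNat_false]

theorem numV_last (D : BPD n) {i : ℕ} (hi : i ≤ n) : D.numV i n = i := by
  induction i with
  | zero =>
    rw [numV, Nat.count_iff_forall_not]
    intro c hc
    simp [vEdge_zero D hc]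
  | succ i ih =>
    rw [numV_succ_left D hi le_rfl, ih (by omega), hEdge_last]
    rfl

theorem mem_blanks {D : BPD n} {i j : Fin n} : (i, j) ∈ D.blanks ↔ D.tile i j = Tile.blank := by
  simp [blanks]

/-- A bumpless pipe dream can be reconstructed from its south-east corner, as soon as each tile is
known from its south and its east edge. -/
theorem eq_of_tile_eq {D E : BPD n}
    (H : ∀ i j, (D.tile i j).south = (E.tile i j).south → (D.tile i j).east = (E.tile i j).east →
      D.tile i j = E.tile i j) : D = E := by
  have key : ∀ k l : ℕ, ∀ i j : Fin n, (i : ℕ) + 1 + k = n → (j : ℕ) + 1 + l = n →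
      D.tile i j = E.tile i j := by
    intro k
    induction k with
    | zero =>
      intro l
      induction l with
      | zero =>
        intro i j hi hj
        apply H
        · rw [D.southBorder _ _ hi, E.southBorder _ _ hi]
        · rw [D.eastBorder _ _ hj, E.eastBorder _ _ hj]
      | succ l ihl =>
        intro i j hi hj
        apply H
        · rw [D.southBorder _ _ hi, E.southBorder _ _ hi]
        · rw [D.horiz i j ⟨j + 1, by omega⟩ rfl, E.horiz i j ⟨j + 1, by omega⟩ rfl,
            ihl i _ hi (by simp only; omega)]
    | succ k ihk =>
      intro l
      have hs : ∀ i j : Fin n, (i : ℕ) + 1 + (k + 1) = n →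
          (D.tile i j).south = (E.tile i j).south := by
        intro i j hi
        rw [D.vert i ⟨i + 1, by omega⟩ j rfl, E.vert i ⟨i + 1, by omega⟩ j rfl,
            ihk (n - 1 - j) ⟨i + 1, by omega⟩ j (by simp only; omega) (by omega)]
      induction l with
      | zero =>
        intro i j hi hj
        apply H _ _ (hs i j hi)
        rw [D.eastBorder _ _ hj, E.eastBorder _ _ hj]
      | succ l ihl =>
        intro i j hi hj
        apply H _ _ (hs i j hi)
        rw [D.horiz i j ⟨j + 1, by omega⟩ rfl, E.horiz i j ⟨j + 1, by omega⟩ rfl,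
            ihl i _ hi (by simp only; omega)]
  ext i j
  rw [key (n - 1 - i) (n - 1 - j) i j (by omega) (by omega)]

end BPD

/-! ### Permutations with at most one descent -/

/-- `π` is increasing on the positions `0, ..., d` and on the positions `d + 1, d + 2, ...`. -/
structure IncreasingAround {n : ℕ} (π : Equiv.Perm (Fin n)) (d : ℕ) : Prop where
  left : ∀ ⦃k l : Fin n⦄, k < l → (l : ℕ) ≤ d → π k < π l
  right : ∀ ⦃k l : Fin n⦄, d < (k : ℕ) → k < l → π k < π l

theorem increasingAround_of_isDescent {n : ℕ} {π : Equiv.Perm (Fin n)} {d : ℕ}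
    (hd : ∀ i : ℕ, IsDescent π i → i = d) : IncreasingAround π d := by
  have step : ∀ (k : ℕ) (hk : k + 1 < n), k ≠ d → π ⟨k, by omega⟩ < π ⟨k + 1, hk⟩ := by
    intro k hk hkd
    refine lt_of_le_of_ne (not_lt.1 fun h => hkd (hd k ⟨hk, h⟩)) fun h => ?_
    have := congrArg Fin.val (π.injective h)
    simp at this
  have main : ∀ (m k : ℕ) (hk : k + m + 1 < n), (k + m + 1 ≤ d ∨ d < k) →
      π ⟨k, by omega⟩ < π ⟨k + m + 1, hk⟩ := by
    intro m
    induction m with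
    | zero => exact fun k hk h => step k hk (by omega)
    | succ m ih =>
      exact fun k hk h => (ih k (by omega) (by omega)).trans (step (k + m + 1) (by omega) (by omega))
  constructor
  · intro k l hkl hl
    have := main (l - k - 1) k (by omega) (by omega)
    have e : (⟨k + (l - k - 1) + 1, by omega⟩ : Fin n) = l := Fin.ext (by simp only; omega)
    rwa [e] at this
  · intro k l hk hkl
    have := main (l - k - 1) k (by omega) (by omega)
    have e : (⟨k + (l - k - 1) + 1, by omega⟩ : Fin n) = l := Fin.ext (by simp only; omega)
    rwa [e] at this

/-! ### The bumpless pipe dreams of a Grassmannian permutation -/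

/-- The labels in `g` increase, where `none` stands for a missing label. -/
def SortedLabels (g : ℕ → Option ℕ) : Prop :=
  ∀ s t x y, s < t → g s = some x → g t = some y → x < y

theorem SortedLabels.congr_of_swap {g g' : ℕ → Option ℕ} {j : ℕ} (hg' : SortedLabels g')
    (hne : ∀ s, s ≠ j → s ≠ j + 1 → g s = g' s)
    (h : (g j = g' j ∧ g (j + 1) = g' (j + 1)) ∨
      (g j = g' (j + 1) ∧ g (j + 1) = g' j ∧ (g j = none ∨ g (j + 1) = none))) :
    SortedLabels g := by
  intro s t x y hst hx hy
  rcases h with ⟨h1, h2⟩ | ⟨h1, h2, h3⟩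
  · have : g = g' := by
      funext s
      by_cases hs : s = j
      · rw [hs, h1]
      by_cases hs' : s = j + 1
      · rw [hs', h2]
      exact hne s hs hs'
    rw [this] at hx hy
    exact hg' s t x y hst hx hy
  · have e : ∀ s, g s = g' (if s = j then j + 1 else if s = j + 1 then j else s) := by
      intro s
      split_ifs with h h'
      · rw [h, h1]
      · rw [h', h2]
      · exact hne s h h'
    by_cases hsj : s = j ∧ t = j + 1
    · obtain ⟨rfl, rfl⟩ := hsj
      rcases h3 with h3 | h3 <;> simp_all
    · rw [e] at hx hy
      refine hg' _ _ x y ?_ hx hy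
      split_ifs <;> omega

namespace BPD

variable {n : ℕ}

/-- `D` consists of a lower part (the rows below row `d`), in which it agrees with the Rothe bumpless
pipe dream of `π`, and of an upper part (the rows `0, ..., d`) without crossings. If `π`
is increasing on both sides of `d`, this characterizes the elements of `BPD(π)`. -/
structure IsSplit (π : Equiv.Perm (Fin n)) (d : ℕ) (D : BPD n) : Prop where
  lower : ∀ i j : Fin n, d < (i : ℕ) → D.tile i j = (rothe π).tile i j
  upper : ∀ i j : Fin n, (i : ℕ) ≤ d → D.tile i j ≠ Tile.cross

/-- The labels, from north-west to south-east, on the path that consists of the top edges of the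
cells `(i, 0), ..., (i, j - 1)`, the left edge of the cell `(i, j)`, the bottom edges of the cells
`(i, j), ..., (i, n - 1)` and the edges of the east border in the rows `i + 1, ..., d`. An edge that
no pipe meets has no label. -/
def labelsAt (D : BPD n) (v h : ℕ → ℕ → ℕ) (d i j s : ℕ) : Option ℕ :=
  if s < j then (if D.vEdge i s then some (v i s) else none)
  else if s = j then (if D.hEdge i j then some (h i j) else none)
  else if s ≤ n then (if D.vEdge (i + 1) (s - 1) then some (v (i + 1) (s - 1)) else none)
  else if i + (s - n) ≤ d ∧ i + (s - n) < n then some (h (i + (s - n)) n) else none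

/-- At a crossing the larger label leaves to the north. So labels that are sorted after a cell has
been passed did not meet in a crossing there, and have been sorted before. -/
theorem sortedLabels_of_succ {D : BPD n} {v h : ℕ → ℕ → ℕ} {d : ℕ} {i j : Fin n}
    (hcell : match D.tile i j with
      | Tile.cross => v i j = max (v (i + 1) j) (h i j) ∧ h i (j + 1) = min (v (i + 1) j) (h i j)
      | Tile.blank => True
      | Tile.horizontal => h i (j + 1) = h i j
      | Tile.vertical => v i j = v (i + 1) j
      | Tile.rElbow => h i (j + 1) = v (i + 1) j
      | Tile.jElbow => v i j = h i j)
    (hs : SortedLabels (D.labelsAt v h d i (j + 1))) :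
    D.tile i j ≠ Tile.cross ∧ SortedLabels (D.labelsAt v h d i j) := by
  have hj := j.2
  have a1 : D.labelsAt v h d i j j = if (D.tile i j).west then some (h i j) else none := by
    simp [labelsAt, hEdge_eq_west]
  have a2 : D.labelsAt v h d i j (j + 1) =
      if (D.tile i j).south then some (v (i + 1) j) else none := by
    have : (j : ℕ) + 1 ≤ n := hj
    simp [labelsAt, this, vEdge_succ]
  have b1 : D.labelsAt v h d i (j + 1) j = if (D.tile i j).north then some (v i j) else none := by
    simp [labelsAt, vEdge_eq_north]
  have b2 : D.labelsAt v h d i (j + 1) (j + 1) =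
      if (D.tile i j).east then some (h i (j + 1)) else none := by
    simp [labelsAt, hEdge_succ]
  have hne : ∀ s : ℕ, s ≠ j → s ≠ j + 1 → D.labelsAt v h d i j s = D.labelsAt v h d i (j + 1) s := by
    intro s h1 h2
    have e1 : (s < (j : ℕ) + 1) ↔ s < j := by omega
    simp [labelsAt, h1, h2, e1]
  cases ht : D.tile i j <;>
    simp only [ht, Tile.west, Tile.south, Tile.north, Tile.east, if_true] at hcell a1 a2 b1 b2
  case cross =>
    have := hs _ _ _ _ (Nat.lt_succ_self _) b1 b2
    omega
  all_goals
    refine ⟨by simp, hs.congr_of_swap hne ?_⟩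
    rw [a1, a2, b1, b2]
    simp [hcell]

theorem HasPerm.upper_ne_cross {D : BPD n} {π : Equiv.Perm (Fin n)} {d : ℕ}
    (hπ : IncreasingAround π d) (hD : D.HasPerm π) (i j : Fin n) (hi : (i : ℕ) ≤ d) :
    D.tile i j ≠ Tile.cross := by
  obtain ⟨v, h, -, hcell, hend⟩ := hD
  -- Passing the cells of a row from east to west.
  have row : ∀ i : Fin n, SortedLabels (D.labelsAt v h d i n) → ∀ m j : ℕ, j + m = n →
      SortedLabels (D.labelsAt v h d i j) := by
    intro i hs m
    induction m with
    | zero => rintro j rfl; exact hs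
    | succ m ih =>
      intro j hj
      exact (sortedLabels_of_succ (hcell i ⟨j, by omega⟩) (ih (j + 1) (by omega))).2
  have all : ∀ (a : ℕ) (ha : a < n), a ≤ d → SortedLabels (D.labelsAt v h d a n) := by
    intro a
    induction a with
    | zero =>
      intro ha _
      -- At the top only the labels of the east border are left.
      have e : ∀ s x, D.labelsAt v h d 0 n s = some x →
          n ≤ s ∧ ∃ hs : s - n < n, s - n ≤ d ∧ x = π ⟨s - n, hs⟩ := by
        intro s x hx
        simp only [labelsAt] at hx
        split_ifs at hx with h1 h2 h3 h4 h5 h6 h7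
        · rw [vEdge_zero D h1] at h2; cases h2
        · subst h3
          simp only [Option.some.injEq] at hx
          refine ⟨le_rfl, by omega, by omega, ?_⟩
          simp only [Nat.sub_self]
          rw [← hx, ← hend]
        · omega
        · simp only [Option.some.injEq] at hx
          refine ⟨by omega, by omega, by omega, ?_⟩
          rw [← hx, ← hend]
          simp
      intro s t x y hst hx hy
      obtain ⟨h1, h2, h3, rfl⟩ := e s x hx
      obtain ⟨h4, h5, h6, rfl⟩ := e t y hy
      exact hπ.left (Fin.mk_lt_mk.2 (by omega)) h6
    | succ a ih =>
      intro ha had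
      have h0 := row ⟨a, by omega⟩ (ih (by omega) (by omega)) n 0 (by omega)
      -- The labels at the beginning of a row are those at the end of the row below it.
      have e : ∀ s, D.labelsAt v h d (a + 1) n s = D.labelsAt v h d a 0 (s + 1) := by
        intro s
        simp only [labelsAt]
        rcases lt_trichotomy s n with hs | rfl | hs
        · have h1 : s + 1 ≤ n := hs
          simp [hs, h1]
        · have h1 : s + 1 - s = 1 := by omega
          simp [h1, hEdge_last, had, ha]
        · have h1 : ¬ s < n := by omega
          have h2 : s ≠ n := by omega
          have h3 : ¬ s ≤ n := by omega
          have h4 : ¬ s + 1 ≤ n := by omega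
          have h5 : a + (s + 1 - n) = a + 1 + (s - n) := by omega
          simp [h1, h2, h3, h4, h5]
      intro s t x y hst hx hy
      rw [e] at hx hy
      exact h0 _ _ x y (by omega) hx hy
  exact (sortedLabels_of_succ (hcell i j)
    (row i (all i i.2 hi) (n - (j + 1)) (j + 1) (by omega))).1

theorem rothe_north (π : Equiv.Perm (Fin n)) (i j : Fin n) :
    ((rothe π).tile i j).north = decide (π.symm j < i) := by
  have h1 : j = π i ↔ π.symm j = i := by rw [Equiv.symm_apply_eq]
  simp only [rothe, h1]
  split_ifs <;> simp [Tile.north] <;> omega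

theorem rothe_south (π : Equiv.Perm (Fin n)) (i j : Fin n) :
    ((rothe π).tile i j).south = decide (π.symm j ≤ i) := by
  have h1 : j = π i ↔ π.symm j = i := by rw [Equiv.symm_apply_eq]
  simp only [rothe, h1]
  split_ifs <;> simp [Tile.south] <;> omega

theorem rothe_west (π : Equiv.Perm (Fin n)) (i j : Fin n) :
    ((rothe π).tile i j).west = decide (π i < j) := by
  simp only [rothe]
  split_ifs <;> simp [Tile.west] <;> omega

theorem rothe_east (π : Equiv.Perm (Fin n)) (i j : Fin n) :
    ((rothe π).tile i j).east = decide (π i ≤ j) := by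
  simp only [rothe]
  split_ifs <;> simp [Tile.east] <;> omega

theorem tile_eq_of_edges {s t : Tile} (h1 : s.north = t.north) (h2 : s.south = t.south)
    (h3 : s.west = t.west) (h4 : s.east = t.east) : s = t := by
  cases s <;> cases t <;> simp_all [Tile.north, Tile.south, Tile.west, Tile.east]

/-- In a row `i` below row `d`, provided that only the columns of `π 0, ..., π i` are entered from the
south, by the pipes of the same labels: a pipe that turns before column `π i` leaves the row with a
label smaller than `π i`, and if some cell from column `π i` on has no pipe on its east edge, a
larger label leaves the row. -/
theorem east_eq_of_lower {D : BPD n} {π : Equiv.Perm (Fin n)} {d : ℕ}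
    (hπ : IncreasingAround π d) {v h : ℕ → ℕ → ℕ}
    (hcell : ∀ i j : Fin n,
      match D.tile i j with
      | Tile.cross => v i j = max (v (i + 1) j) (h i j) ∧ h i (j + 1) = min (v (i + 1) j) (h i j)
      | Tile.blank => True
      | Tile.horizontal => h i (j + 1) = h i j
      | Tile.vertical => v i j = v (i + 1) j
      | Tile.rElbow => h i (j + 1) = v (i + 1) j
      | Tile.jElbow => v i j = h i j)
    (hend : ∀ i : Fin n, h i n = π i) {i : Fin n} (hi : d < (i : ℕ))
    (hsouth : ∀ j : Fin n, (D.tile i j).south = decide (π.symm j ≤ i))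
    (hlabel : ∀ j : Fin n, (D.tile i j).south = true → v (i + 1) j = j) (j : Fin n) :
    (D.tile i j).east = decide (π i ≤ j) := by
  -- All columns up to column `π i` are entered from the south.
  have hleft : ∀ j : Fin n, j ≤ π i → (D.tile i j).south = true := by
    intro j hj
    rw [hsouth, decide_eq_true_iff]
    by_contra hlt
    have := hπ.right hi (not_le.1 hlt)
    rw [Equiv.apply_symm_apply] at this
    exact absurd hj (not_le.2 this)
  -- Behind a missing east edge all labels are larger than `π i`, so from column `π i` on none is missing.
  have hright : ∀ e : Fin n, π i ≤ e → (D.tile i e).east = true := by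
    intro e he
    by_contra hne
    rw [Bool.not_eq_true] at hne
    have claim : ∀ m : ℕ, (e : ℕ) + 1 + m ≤ n →
        D.hEdge i (e + 1 + m) = true → (e : ℕ) < h i (e + 1 + m) := by
      intro m
      induction m with
      | zero =>
        intro _ hm
        rw [add_zero, hEdge_succ, hne] at hm
        cases hm
      | succ m ih =>
        intro hm hedge
        have ih := ih (by omega)
        have hc := hcell i ⟨e + 1 + m, by omega⟩
        have hl := hlabel ⟨e + 1 + m, by omega⟩
        have e1 := hEdge_succ D i ⟨e + 1 + m, by omega⟩
        have e2 := hEdge_eq_west D i ⟨e + 1 + m, by omega⟩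
        simp only at e1 e2
        rw [show (e : ℕ) + 1 + (m + 1) = e + 1 + m + 1 by omega] at hedge ⊢
        rw [e1] at hedge
        rw [e2] at ih
        cases ht : D.tile i ⟨e + 1 + m, by omega⟩ <;>
          simp only [ht, Tile.east, Tile.west, Tile.south, reduceCtorEq, forall_const] at hc hl hedge ih <;>
          omega
    have h1 := claim (n - (e + 1)) (by omega)
    rw [show (e : ℕ) + 1 + (n - (e + 1)) = n by omega, hend] at h1
    have := h1 (hEdge_last D i)
    omega
  by_cases hj : π i ≤ j
  · rw [hright j hj, decide_eq_true hj]
  · rw [decide_eq_false hj]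
    by_contra hne
    rw [Bool.not_eq_false] at hne
    have claim : ∀ m : ℕ, (j : ℕ) + 1 + m ≤ n →
        D.hEdge i (j + 1 + m) = true ∧ h i (j + 1 + m) ≤ j := by
      intro m
      induction m with
      | zero =>
        intro _
        rw [add_zero, hEdge_succ]
        refine ⟨hne, ?_⟩
        have hs := hleft j (by omega)
        have hl := hlabel j hs
        have hc := hcell i j
        cases ht : D.tile i j <;>
          simp only [ht, Tile.east, Tile.south, reduceCtorEq] at hc hne hs <;> omega
      | succ m ih =>
        intro hm
        obtain ⟨ih1, ih2⟩ := ih (by omega)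
        have hc := hcell i ⟨j + 1 + m, by omega⟩
        have e1 := hEdge_succ D i ⟨j + 1 + m, by omega⟩
        have e2 := hEdge_eq_west D i ⟨j + 1 + m, by omega⟩
        have hE : (D.tile i ⟨j + 1 + m, by omega⟩).south = true ∨
            (D.tile i ⟨j + 1 + m, by omega⟩).east = true := by
          by_cases hp : π i ≤ ⟨j + 1 + m, by omega⟩
          · exact Or.inr (hright _ hp)
          · exact Or.inl (hleft _ (not_le.1 hp).le)
        simp only at e1 e2
        rw [show (j : ℕ) + 1 + (m + 1) = j + 1 + m + 1 by omega, e1]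
        rw [e2] at ih1
        cases ht : D.tile i ⟨j + 1 + m, by omega⟩ <;>
          simp only [ht, Tile.east, Tile.west, Tile.south, reduceCtorEq, or_self, true_and] at hc ih1 hE ⊢ <;>
          omega
    have := (claim (n - (j + 1)) (by omega)).2
    rw [show (j : ℕ) + 1 + (n - (j + 1)) = n by omega, hend] at this
    omega

theorem HasPerm.lower_eq {D : BPD n} {π : Equiv.Perm (Fin n)} {d : ℕ}
    (hπ : IncreasingAround π d) (hD : D.HasPerm π) (i j : Fin n) (hi : d < (i : ℕ)) :
    D.tile i j = (rothe π).tile i j := by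
  obtain ⟨v, h, hstart, hcell, hend⟩ := hD
  have row : ∀ i : Fin n, d < (i : ℕ) →
      (∀ j : Fin n, (D.tile i j).south = decide (π.symm j ≤ i)) →
      (∀ j : Fin n, (D.tile i j).south = true → v (i + 1) j = j) →
      (∀ j : Fin n, D.tile i j = (rothe π).tile i j) ∧
        ∀ j : Fin n, (D.tile i j).north = true → v i j = j := by
    intro i hi hsouth hlabel
    have heast := east_eq_of_lower hπ hcell hend hi hsouth hlabel
    have hw : ∀ j : Fin n, (D.tile i j).west = decide (π i < j) := by
      intro j
      rcases Nat.eq_zero_or_pos (j : ℕ) with h0 | h0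
      · rw [D.westBorder i j h0, eq_comm, decide_eq_false_iff_not]
        omega
      · rw [← D.horiz i ⟨j - 1, by omega⟩ j (by simp only; omega), heast, decide_eq_decide,
          Fin.le_def, Fin.lt_def]
        simp only
        omega
    have htile : ∀ j : Fin n, D.tile i j = (rothe π).tile i j := by
      intro j
      have h1 := hsouth j
      have h2 := heast j
      have h3 := hw j
      rw [← rothe_south] at h1
      rw [← rothe_east] at h2
      rw [← rothe_west] at h3
      refine tile_eq_of_edges ?_ h1 h3 h2
      cases ht : D.tile i j <;> cases ht' : (rothe π).tile i j <;>
        simp_all [Tile.north, Tile.south, Tile.west, Tile.east]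
    refine ⟨htile, fun j hj => ?_⟩
    have hlab : ∀ m : ℕ, m ≤ n → D.hEdge i m = true → h i m = π i := by
      intro m
      induction m with
      | zero => intro _ hm; rw [hEdge_zero D i.2] at hm; cases hm
      | succ m ih =>
        intro hm hedge
        have e1 := hEdge_succ D i ⟨m, hm⟩
        have e2 := hEdge_eq_west D i ⟨m, hm⟩
        simp only at e1 e2
        have ih := ih (by omega)
        rw [e1] at hedge
        rw [e2] at ih
        have hc := hcell i ⟨m, hm⟩
        have hl := hlabel ⟨m, hm⟩
        have h3 := hw ⟨m, hm⟩
        have h2 := heast ⟨m, hm⟩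
        cases ht : D.tile i ⟨m, hm⟩ <;>
          simp only [ht, Tile.east, Tile.west, Tile.south, reduceCtorEq, Fin.lt_def, Fin.le_def,
            true_eq_decide_iff, false_eq_decide_iff, forall_const] at hc hl hedge ih h2 h3 <;>
          omega
    have hc := hcell i j
    have hl := hlabel j
    have h3 := hw j
    have h4 := hlab j j.2.le
    rw [hEdge_eq_west] at h4
    have h5 := rothe_north π i j
    rw [← htile, hj] at h5
    have h6 := hsouth j
    cases ht : D.tile i j <;>
      simp only [ht, Tile.north, Tile.west, Tile.south, reduceCtorEq, Fin.lt_def, Fin.le_def,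
        true_eq_decide_iff, false_eq_decide_iff, forall_const] at hc hl hj h3 h4 h5 h6 <;>
      omega
  have all : ∀ (m : ℕ) (i : Fin n), (i : ℕ) + 1 + m = n → d < (i : ℕ) →
      (∀ j : Fin n, D.tile i j = (rothe π).tile i j) ∧
        ∀ j : Fin n, (D.tile i j).north = true → v i j = j := by
    intro m
    induction m with
    | zero =>
      intro i him hi
      have e : (i : ℕ) + 1 = n := him
      refine row i hi (fun j => ?_) (fun j _ => ?_)
      · rw [D.southBorder i j e, eq_comm, decide_eq_true_iff, Fin.le_def]
        omega
      · rw [e, hstart]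
    | succ m ih =>
      intro i him hi
      obtain ⟨ih1, ih2⟩ := ih ⟨i + 1, by omega⟩ (by simp only; omega) (by simp only; omega)
      have hv := fun j => D.vert i ⟨i + 1, by omega⟩ j rfl
      refine row i hi (fun j => ?_) (fun j hj => ?_)
      · rw [hv, ih1, rothe_north, decide_eq_decide, Fin.le_def, Fin.lt_def]
        simp only
        omega
      · rw [hv] at hj
        exact ih2 j hj
  exact (all (n - (i + 1)) i (by omega) hi).1 j

theorem HasPerm.isSplit {D : BPD n} {π : Equiv.Perm (Fin n)} {d : ℕ}
    (hπ : IncreasingAround π d) (hD : D.HasPerm π) : D.IsSplit π d :=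
  ⟨hD.lower_eq hπ, hD.upper_ne_cross hπ⟩

end BPD

/-- The one-line notation of `π`, continued by fixed points to a permutation of `ℕ`. -/
def extendNat {n : ℕ} (π : Equiv.Perm (Fin n)) (k : ℕ) : ℕ :=
  if h : k < n then π ⟨k, h⟩ else k

section extendNat

variable {n : ℕ} (π : Equiv.Perm (Fin n))

theorem extendNat_val (k : Fin n) : extendNat π k = π k := by
  simp [extendNat]

theorem extendNat_injective : Function.Injective (extendNat π) := by
  intro k l h
  simp only [extendNat] at h
  split_ifs at h with h1 h2 h3
  · simpa using π.injective (Fin.ext h)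
  · have := (π ⟨k, h1⟩).2; omega
  · have := (π ⟨l, h3⟩).2; omega
  · exact h

end extendNat

namespace IncreasingAround

variable {n : ℕ} {π : Equiv.Perm (Fin n)} {d : ℕ}

theorem card_left (hπ : IncreasingAround π d) {k : Fin n} (hk : (k : ℕ) ≤ d) :
    (Finset.univ.filter fun c : Fin n => c < π k ∧ (π.symm c : ℕ) ≤ d).card = k := by
  have : (Finset.univ.filter fun c : Fin n => c < π k ∧ (π.symm c : ℕ) ≤ d) =
      (Finset.Iio k).map π.toEmbedding := by
    ext c
    simp only [Finset.mem_filter, Finset.mem_univ, true_and, Finset.mem_map_equiv,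
      Finset.mem_Iio]
    constructor
    · rintro ⟨h1, h2⟩
      by_contra h
      rcases (not_lt.1 h).eq_or_lt with h3 | h3
      · simp [h3] at h1
      · have := hπ.left h3 h2
        rw [Equiv.apply_symm_apply] at this
        exact absurd h1 this.asymm
    · intro h
      have := hπ.left h hk
      rw [Equiv.apply_symm_apply] at this
      exact ⟨this, by omega⟩
  rw [this, Finset.card_map, Fin.card_Iio]

theorem card_right (hπ : IncreasingAround π d) {k : Fin n} (hk : d < (k : ℕ)) :
    (Finset.univ.filter fun c : Fin n => c < π k ∧ ¬ (π.symm c : ℕ) ≤ d).card = k - d - 1 := by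
  have hd : d < n := by omega
  have : (Finset.univ.filter fun c : Fin n => c < π k ∧ ¬ (π.symm c : ℕ) ≤ d) =
      (Finset.Ioo ⟨d, hd⟩ k).map π.toEmbedding := by
    ext c
    simp only [Finset.mem_filter, Finset.mem_univ, true_and, Finset.mem_map_equiv,
      Finset.mem_Ioo, Fin.lt_def, not_le]
    constructor
    · rintro ⟨h1, h2⟩
      refine ⟨h2, ?_⟩
      by_contra h
      rcases (not_lt.1 h).eq_or_lt with h3 | h3
      · simp [Fin.ext h3] at h1
      · have := hπ.right hk h3
        rw [Equiv.apply_symm_apply] at this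
        exact absurd h1 (not_lt.2 this.le)
    · rintro ⟨h1, h2⟩
      have := hπ.right h1 h2
      rw [Equiv.apply_symm_apply] at this
      exact ⟨this, h1⟩
  rw [this, Finset.card_map, Fin.card_Ioo]

end IncreasingAround

namespace BPD

variable {n : ℕ}

theorem numV_eq_card (D : BPD n) (i : ℕ) (j : Fin n) :
    D.numV i j = (Finset.univ.filter fun c : Fin n => c < j ∧ D.vEdge i c = true).card := by
  rw [numV, Nat.count_eq_card_filter_range, ← Finset.card_map Fin.valEmbedding]
  congr 1
  ext c
  simp only [Finset.mem_filter, Finset.mem_range, Finset.mem_map, Finset.mem_univ, true_and,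
    Fin.valEmbedding_apply]
  constructor
  · rintro ⟨h1, h2⟩
    exact ⟨⟨c, by omega⟩, ⟨h1, h2⟩, rfl⟩
  · rintro ⟨a, ⟨h1, h2⟩, rfl⟩
    exact ⟨h1, h2⟩

namespace IsSplit

variable {π : Equiv.Perm (Fin n)} {d : ℕ} {D : BPD n}

theorem vEdge_succ_iff (hD : D.IsSplit π d) (hd : d < n) (j : Fin n) :
    D.vEdge (d + 1) j = true ↔ (π.symm j : ℕ) ≤ d := by
  by_cases h : d + 1 < n
  · have := D.vEdge_eq_north ⟨d + 1, h⟩ j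
    simp only at this
    rw [this, hD.lower _ _ (Nat.lt_succ_self d), rothe_north, decide_eq_true_iff, Fin.lt_def]
    simp only
    omega
  · rw [show d + 1 = n by omega, vEdge_last]
    simp only [true_iff]
    omega

/-- The pipes that enter the upper part are, from left to right, `π 0, ..., π d`. -/
theorem extendNat_numV (hD : D.IsSplit π d) (hπ : IncreasingAround π d) (hd : d < n) {j : Fin n}
    (hj : D.vEdge (d + 1) j = true) : extendNat π (D.numV (d + 1) j) = j := by
  rw [hD.vEdge_succ_iff hd] at hj
  have := hπ.card_left hj
  rw [Equiv.apply_symm_apply] at this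
  simp only [numV_eq_card, hD.vEdge_succ_iff hd]
  rw [this, extendNat_val, Equiv.apply_symm_apply]

theorem extendNat_sub_numV (hD : D.IsSplit π d) (hπ : IncreasingAround π d) (hd : d < n)
    {j : Fin n} (hj : ¬ D.vEdge (d + 1) j = true) :
    extendNat π (d + 1 + j - D.numV (d + 1) j) = j := by
  rw [hD.vEdge_succ_iff hd] at hj
  have h1 := hπ.card_right (not_le.1 hj)
  rw [Equiv.apply_symm_apply] at h1
  have h2 := Finset.card_filter_add_card_filter_not (s := Finset.univ.filter fun c : Fin n => c < j)
    (fun c => (π.symm c : ℕ) ≤ d)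
  rw [Finset.filter_filter, Finset.filter_filter, h1] at h2
  have h3 : (Finset.univ.filter fun c : Fin n => c < j).card = j := by
    rw [Finset.filter_gt_eq_Iio, Fin.card_Iio]
  simp only [numV_eq_card, hD.vEdge_succ_iff hd]
  rw [show d + 1 + (j : ℕ) - (Finset.univ.filter fun c : Fin n => c < j ∧
    (π.symm c : ℕ) ≤ d).card = π.symm j by omega, extendNat_val, Equiv.apply_symm_apply]

/-- In the upper part, the pipe on an edge is the `numV`-th pipe of the respective row. -/
theorem hasPerm (hD : D.IsSplit π d) (hπ : IncreasingAround π d) (hd : 0 < n → d < n) :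
    D.HasPerm π := by
  refine ⟨fun i j => if i ≤ d then extendNat π (D.numV i j) else j,
    fun i j => if i ≤ d then extendNat π (D.numV i j) else extendNat π i, ?_, ?_, ?_⟩
  · intro j
    have := hd j.pos
    simp only
    rw [if_neg (by omega)]
  · intro i j
    have hdn := hd i.pos
    by_cases hi : (i : ℕ) ≤ d
    · have hv : (D.tile i j).south = true → (if (i : ℕ) + 1 ≤ d then
          extendNat π (D.numV (i + 1) j) else j) = extendNat π (D.numV (i + 1) j) := by
        intro hs
        split_ifs with h
        · rfl
        · have e : (i : ℕ) = d := by omega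
          rw [← vEdge_succ] at hs
          rw [e] at hs ⊢
          exact (hD.extendNat_numV hπ hdn hs).symm
      have h1 := D.numV_succ_left i.2 j.2.le
      have h2 := D.numV_succ i j
      rw [hEdge_eq_west] at h1
      rw [vEdge_eq_north] at h2
      simp only [hi, if_true]
      have h4 := hD.upper i j hi
      cases ht : D.tile i j <;>
        simp only [ht, Tile.north, Tile.south, Tile.west, Bool.toNat_true, Bool.toNat_false,
          add_zero, forall_const] at h1 h2 hv ⊢
      case cross => exact absurd ht h4
      case horizontal => rw [h2]
      case vertical => rw [hv, h1]
      case rElbow => rw [hv, h1, h2]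
    · have h1 := hD.lower i j (by omega)
      have h2 : ¬ (i : ℕ) + 1 ≤ d := by omega
      have e := extendNat_val π i
      simp only [hi, h2, if_false, h1, e]
      simp only [rothe]
      split_ifs with h3 h4 h5 h6 <;> simp only [h3]
      omega
  · intro i
    simp only
    split_ifs
    · rw [numV_last D i.2.le, extendNat_val]
    · rw [extendNat_val]

end IsSplit

theorem rothe_isSplit {π : Equiv.Perm (Fin n)} {d : ℕ} (hπ : IncreasingAround π d) :
    (rothe π).IsSplit π d := by
  refine ⟨fun _ _ _ => rfl, fun i j hi => ?_⟩
  simp only [rothe]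
  split_ifs with h1 h2 h3 <;> simp only [ne_eq, reduceCtorEq, not_false_eq_true, not_true]
  have := hπ.left h3 hi
  rw [Equiv.apply_symm_apply] at this
  exact this.asymm h2

end BPD

/-! ### Reflecting the blank tiles -/

namespace BPD

variable {n : ℕ}

/-- The pipe dream whose crosses are the blank tiles of `D`, reflected vertically in the rows
`0, ..., d`. (Only cells above the antidiagonal are kept; for the bumpless pipe dreams at hand these
are all, see `IsSplit.mem_reflect`.) -/
def reflect (D : BPD n) (d : ℕ) : PD n where
  cross := Finset.univ.filter fun p =>
    (p.1 : ℕ) + p.2 + 1 < n ∧ ∃ i : Fin n, (i : ℕ) + p.1 = d ∧ (i, p.2) ∈ D.blanks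
  above p hp := by
    simp only [Finset.mem_filter, Finset.mem_univ, true_and] at hp
    exact hp.1

/-- To the east of a cell without a pipe on its east edge, a pipe enters the row from the south. -/
theorem exists_south_of_east_eq_false (D : BPD n) {i j : Fin n} (h : (D.tile i j).east = false) :
    ∃ c : Fin n, j < c ∧ (D.tile i c).south = true := by
  by_cases hj : (j : ℕ) + 1 = n
  · rw [D.eastBorder i j hj] at h
    cases h
  · have hw := D.horiz i j ⟨j + 1, by omega⟩ rfl
    rw [h] at hw
    by_cases hs : (D.tile i ⟨j + 1, by omega⟩).south = true
    · exact ⟨_, Fin.lt_def.2 (by simp), hs⟩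
    · obtain ⟨c, hc, hc'⟩ := exists_south_of_east_eq_false D (i := i) (j := ⟨j + 1, by omega⟩) (by
        generalize D.tile i ⟨j + 1, by omega⟩ = t at hw hs ⊢
        revert hw hs
        cases t <;> simp [Tile.west, Tile.south, Tile.east])
      exact ⟨c, lt_trans (Fin.lt_def.2 (by simp)) hc, hc'⟩
termination_by n - j

namespace IsSplit

variable {π : Equiv.Perm (Fin n)} {d : ℕ} {D : BPD n}

theorem le_of_blank (hD : D.IsSplit π d) (hπ : IncreasingAround π d) {i j : Fin n}
    (h : D.tile i j = Tile.blank) : (i : ℕ) ≤ d := by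
  by_contra hi
  rw [not_le] at hi
  rw [hD.lower i j hi] at h
  have h1 := rothe_south π i j
  have h2 := rothe_east π i j
  rw [h] at h1 h2
  simp only [Tile.south, Tile.east, false_eq_decide_iff, not_le] at h1 h2
  have := hπ.right hi h1
  rw [Equiv.apply_symm_apply] at this
  exact this.asymm h2

/-- The pipes of the upper part stay to the left of an antidiagonal: a pipe that leaves a row to the
north has another pipe entering the row to its right. -/
theorem lt_of_south (hD : D.IsSplit π d) (hd : d < n) (m : ℕ) : ∀ {i j : Fin n},
    (i : ℕ) + m = d → (D.tile i j).south = true → m + j < n := by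
  induction m with
  | zero => intro i j _ _; omega
  | succ m ih =>
    intro i j hi hs
    have hi' : (i : ℕ) + 1 < n := by omega
    rw [D.vert i ⟨i + 1, hi'⟩ j rfl] at hs
    have hc := hD.upper ⟨i + 1, hi'⟩ j (by simp only; omega)
    obtain ⟨c, hjc, hcs⟩ := D.exists_south_of_east_eq_false (i := ⟨i + 1, hi'⟩) (j := j) (by
      cases ht : D.tile ⟨i + 1, hi'⟩ j <;> simp_all [Tile.north, Tile.east])
    have := ih (by simp only; omega) hcs
    omega

theorem lt_of_blank (hD : D.IsSplit π d) (hd : d < n) {m : ℕ} {i j : Fin n}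
    (hi : (i : ℕ) + m = d) (h : D.tile i j = Tile.blank) : m + j + 1 < n := by
  obtain ⟨c, hjc, hcs⟩ := D.exists_south_of_east_eq_false (i := i) (j := j) (by rw [h]; rfl)
  have := hD.lt_of_south hd m hi hcs
  omega

theorem mem_reflect (hD : D.IsSplit π d) (hd : 0 < n → d < n) {a j : Fin n} :
    (a, j) ∈ (D.reflect d).cross ↔ ∃ i : Fin n, (i : ℕ) + a = d ∧ (i, j) ∈ D.blanks := by
  simp only [reflect, Finset.mem_filter, Finset.mem_univ, true_and]
  refine and_iff_right_of_imp ?_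
  rintro ⟨i, hi, h⟩
  exact hD.lt_of_blank (hd i.pos) hi (mem_blanks.1 h)

theorem mem_reflect_of_add_eq (hD : D.IsSplit π d) (hd : 0 < n → d < n) {a i j : Fin n}
    (h : (i : ℕ) + a = d) : (a, j) ∈ (D.reflect d).cross ↔ D.tile i j = Tile.blank := by
  rw [hD.mem_reflect hd, ← mem_blanks]
  constructor
  · rintro ⟨k, hk, hb⟩
    rwa [show i = k from Fin.ext (by omega)]
  · exact fun hb => ⟨i, h, hb⟩

/-- Follow the diagonal from a blank tile `(i, j)` to the north-west. The number of pipes that pass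
to the left decreases by at most one in each step. As long as it has decreased in every step, a pipe
runs through the bottom edge of the cell `(k, l)` that is reached, which is therefore not blank. -/
theorem numV_diagonal (hD : D.IsSplit π d) {i j : Fin n} (hi : (i : ℕ) ≤ d)
    (hb : D.tile i j = Tile.blank) (t : ℕ) : ∀ k l : ℕ, k + t + 1 = i → l + t + 1 = j →
    D.numV (i + 1) j < D.numV (k + 1) l + t + 1 ∨
      D.numV (i + 1) j = D.numV (k + 1) l + t + 1 ∧ D.vEdge (k + 1) l = true := by
  induction t with
  | zero =>
    intro k l hk hl
    have h1 := D.numV_succ_left i.2 j.2.le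
    rw [hEdge_eq_west, hb] at h1
    have h2 := D.numV_succ i l
    rw [show l + 1 = (j : ℕ) by omega] at h2
    rw [show k + 1 = (i : ℕ) by omega]
    cases hv : D.vEdge i l <;> simp only [hv, Tile.west, Bool.toNat_true, Bool.toNat_false] at h1 h2
    · left; omega
    · right; exact ⟨by omega, rfl⟩
  | succ t ih =>
    intro k l hk hl
    have ih := ih (k + 1) (l + 1) (by omega) (by omega)
    have hk' : k + 1 < n := by omega
    have hl' : l + 1 < n := by omega
    have h1 := D.numV_succ_left hk' hl'.le
    have h2 := D.numV_succ (k + 1) l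
    have h3 := D.vEdge_eq_north ⟨k + 1, hk'⟩ ⟨l, by omega⟩
    have h4 := D.hEdge_succ ⟨k + 1, hk'⟩ ⟨l, by omega⟩
    have h5 := hD.upper ⟨k + 1, hk'⟩ ⟨l, by omega⟩ (by simp only; omega)
    have h6 := D.vEdge_succ ⟨k + 1, hk'⟩ ⟨l + 1, hl'⟩
    have h7 := D.hEdge_eq_west ⟨k + 1, hk'⟩ ⟨l + 1, hl'⟩
    have h8 := hD.upper ⟨k + 1, hk'⟩ ⟨l + 1, hl'⟩ (by simp only; omega)
    simp only at h3 h4 h6 h7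
    have h9 : ¬ (D.vEdge (k + 1) l = true ∧ D.hEdge (k + 1) (l + 1) = true) := by
      rw [h3, h4]
      cases ht : D.tile ⟨k + 1, hk'⟩ ⟨l, by omega⟩ <;> simp_all [Tile.north, Tile.east]
    have h10 : ¬ (D.vEdge (k + 1 + 1) (l + 1) = true ∧ D.hEdge (k + 1) (l + 1) = true) := by
      rw [h6, h7]
      cases ht : D.tile ⟨k + 1, hk'⟩ ⟨l + 1, hl'⟩ <;> simp_all [Tile.south, Tile.west]
    cases hv : D.vEdge (k + 1) l <;> cases hh : D.hEdge (k + 1) (l + 1) <;>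
      simp only [hv, hh, Bool.toNat_true, Bool.toNat_false, and_true, and_false, and_self,
        not_true, not_false_eq_true, Bool.not_eq_true, reduceCtorEq] at h1 h2 h9 h10 ih ⊢ <;>
      first
        | omega
        | (simp only [h10, reduceCtorEq, and_false, or_false] at ih; omega)

/-- For two blank tiles on the same diagonal, the numbers of pipes to their left do not differ by the
distance of their rows. -/
theorem blank_diagonal (hD : D.IsSplit π d) {i j i' j' : Fin n} (hi : (i : ℕ) ≤ d)
    (hb : D.tile i j = Tile.blank) (hb' : D.tile i' j' = Tile.blank) {t : ℕ}
    (hi' : (i' : ℕ) + t = i) (hj' : (j' : ℕ) + t = j)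
    (hN : D.numV (i + 1) j = D.numV (i' + 1) j' + t) : t = 0 := by
  rcases t with _ | t
  · rfl
  · exfalso
    rcases hD.numV_diagonal hi hb t i' j' hi' hj' with h | ⟨-, h⟩
    · omega
    · rw [vEdge_succ, hb'] at h
      cases h

/-- The labels on the top edges of the cells of `D.reflect d`. The strands that correspond to the
vertical edges of `D` carry the labels `π 0, ..., π d` (`π a, ..., π d` in row `a`), the others carry
`π (d + 1), π (d + 2), ...`, in both cases from left to right. -/
def topLabel (π : Equiv.Perm (Fin n)) (d : ℕ) (D : BPD n) (a j : ℕ) : ℕ :=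
  if a ≤ d + 1 then
    if D.vEdge (d + 1 - a) j then extendNat π (a + D.numV (d + 1 - a) j)
    else extendNat π (d + 1 + j - D.numV (d + 1 - a) j)
  else extendNat π (a + j)

/-- The labels on the left edges of the cells of `D.reflect d`. The strands with the labels
`π 0, ..., π d` correspond to the left edges of cells that no pipe of `D` meets. -/
def leftLabel (π : Equiv.Perm (Fin n)) (d : ℕ) (D : BPD n) (a j : ℕ) : ℕ :=
  if a ≤ d then
    if D.hEdge (d - a) j then extendNat π (d + 1 + j - D.numV (d + 1 - a) j)
    else extendNat π (a + D.numV (d + 1 - a) j)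
  else extendNat π (a + j)

theorem label_cell (hD : D.IsSplit π d) (hd : 0 < n → d < n) (a j : Fin n) :
    if (a, j) ∈ (D.reflect d).cross then
      topLabel π d D (a + 1) j = topLabel π d D a j ∧
        leftLabel π d D a j = leftLabel π d D a (j + 1)
    else leftLabel π d D a j = topLabel π d D a j ∧
      topLabel π d D (a + 1) j = leftLabel π d D a (j + 1) := by
  have hdn := hd a.pos
  by_cases ha : (a : ℕ) ≤ d
  · obtain ⟨i, hi⟩ : ∃ i : Fin n, (i : ℕ) + a = d := ⟨⟨d - a, by omega⟩, by simp only; omega⟩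
    have hmem := hD.mem_reflect_of_add_eq hd (j := j) hi
    have h1 := D.numV_succ_left i.2 j.2.le
    have h2 := D.numV_succ (i + 1) j
    have h3 := D.numV_le i j
    rw [hEdge_eq_west] at h1
    rw [vEdge_succ] at h2
    have h4 := hD.upper i j (by omega)
    have h5 : (a : ℕ) + 1 ≤ d + 1 := by omega
    have h6 : (a : ℕ) ≤ d + 1 := by omega
    simp only [hmem, topLabel, leftLabel, h5, h6, ha, if_true]
    rw [show d + 1 - (a + 1) = (i : ℕ) by omega, show d + 1 - a = (i : ℕ) + 1 by omega,
      show d - a = (i : ℕ) by omega, vEdge_eq_north, vEdge_succ, hEdge_eq_west, hEdge_succ]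
    cases ht : D.tile i j <;>
      simp only [ht, Tile.north, Tile.south, Tile.west, Tile.east, Bool.toNat_true,
        Bool.toNat_false, Bool.false_eq_true, if_true, if_false, reduceCtorEq, true_and] at h1 h2 h4 ⊢
    case cross => exact absurd rfl h4
    case blank => constructor <;> congr 1 <;> omega
    all_goals congr 1; omega
  · have hmem : (a, j) ∉ (D.reflect d).cross := by
      rw [hD.mem_reflect hd]
      rintro ⟨i, hi, -⟩
      omega
    rw [if_neg hmem]
    have e : ∀ a : ℕ, d < a → topLabel π d D a j = extendNat π (a + j) := by
      intro a ha
      by_cases had : a = d + 1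
      · subst had
        have h0 : D.numV 0 j = 0 := by
          have := D.numV_mono 0 j.2.le
          rw [numV_last D (Nat.zero_le n)] at this
          omega
        simp [topLabel, vEdge_zero D j.2, h0]
      · rw [topLabel, if_neg (by omega)]
    rw [e _ (not_le.1 ha), e _ (by omega), leftLabel, if_neg ha, leftLabel, if_neg ha]
    exact ⟨rfl, by congr 1; omega⟩

theorem reflect_isReducedWithPerm (hD : D.IsSplit π d) (hπ : IncreasingAround π d)
    (hd : 0 < n → d < n) : (D.reflect d).IsReducedWithPerm π := by
  refine ⟨topLabel π d D, leftLabel π d D, ?_, hD.label_cell hd, ?_, ?_⟩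
  · intro j
    rw [topLabel, if_pos (by omega), Nat.sub_zero, zero_add]
    split_ifs with h
    · exact hD.extendNat_numV hπ (hd j.pos) h
    · exact hD.extendNat_sub_numV hπ (hd j.pos) h
  · intro a
    have := hd a.pos
    rw [leftLabel, numV_zero, add_zero, hEdge_zero D (by omega), add_zero, extendNat_val]
    simp
  · -- The pair of labels at a cross determines the antidiagonal and the number of pipes to the left.
    have key : ∀ p ∈ (D.reflect d).cross, ∃ i : Fin n, (i : ℕ) + p.1 = d ∧
        D.tile i p.2 = Tile.blank ∧ p.1 + D.numV (i + 1) p.2 ≤ d ∧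
        topLabel π d D p.1 p.2 = extendNat π (d + 1 + p.2 - D.numV (i + 1) p.2) ∧
        leftLabel π d D p.1 (p.2 + 1) = extendNat π (p.1 + D.numV (i + 1) p.2) := by
      rintro ⟨a, j⟩ hp
      obtain ⟨i, hi, hb⟩ := (hD.mem_reflect hd).1 hp
      rw [mem_blanks] at hb
      simp only at hi ⊢
      have h1 := D.numV_succ_left i.2 j.2.le
      have h2 := D.numV_succ (i + 1) j
      have h3 := D.numV_mono i j.2.le
      rw [numV_last D i.2.le] at h3
      rw [hEdge_eq_west, hb] at h1
      rw [vEdge_succ, hb] at h2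
      simp only [Tile.west, Tile.south, Bool.toNat_false, add_zero] at h1 h2
      refine ⟨i, hi, hb, by omega, ?_, ?_⟩
      · rw [topLabel, if_pos (by omega), show d + 1 - a = (i : ℕ) + 1 by omega, vEdge_succ, hb]
        rfl
      · rw [leftLabel, if_pos (by omega), show d + 1 - a = (i : ℕ) + 1 by omega,
          show d - a = (i : ℕ) by omega, hEdge_succ, hb, h2]
        rfl
    rintro ⟨a, j⟩ hp ⟨a', j'⟩ hq hpq
    obtain ⟨i, hi, hb, hle, e1, e2⟩ := key _ hp
    obtain ⟨i', hi', hb', hle', e1', e2'⟩ := key _ hq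
    simp only at hi hb hle e1 e2 hi' hb' hle' e1' e2' hpq
    have b := D.numV_le (i + 1) j
    have b' := D.numV_le (i' + 1) j'
    rw [e1, e2, e1', e2', Sym2.eq_iff] at hpq
    simp only [(extendNat_injective π).eq_iff] at hpq
    rcases hpq with ⟨h1, h2⟩ | ⟨h1, h2⟩
    · have ht : (a : ℕ) = a' := by
        rcases le_total (a : ℕ) a' with h | h
        · have := hD.blank_diagonal (by omega) hb hb' (t := a' - a) (by omega) (by omega) (by omega)
          omega
        · have := hD.blank_diagonal (by omega) hb' hb (t := a - a') (by omega) (by omega) (by omega)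
          omega
      exact Prod.ext (Fin.ext ht) (Fin.ext (by simp only; omega))
    · omega

end IsSplit

end BPD

/-! ### Labels in a reduced pipe dream -/

namespace PD

variable {n : ℕ}

/-- `v` and `h` are labels of the top edges and of the left edges of the cells, obtained by following
the pipes of `P`, which leave with the labels `π 0, π 1, ...` to the west. -/
structure IsLabelling (P : PD n) (π : Equiv.Perm (Fin n)) (v h : ℕ → ℕ → ℕ) : Prop where
  start : ∀ j : Fin n, v 0 j = j
  cell : ∀ i j : Fin n,
      if (i, j) ∈ P.cross then v (i + 1) j = v i j ∧ h i j = h i (j + 1)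
      else h i j = v i j ∧ v (i + 1) j = h i (j + 1)
  exit : ∀ i : Fin n, h i 0 = π i

/-- The labels, from north-west to south-east, on the path that consists of the west border in the
rows `0, ..., a - 1`, the top edges of the cells `(a, 0), ..., (a, j - 1)`, the left edge of the cell
`(a, j)`, and the bottom edges of the cells `(a, j), (a, j + 1), ...`. -/
def frontier (v h : ℕ → ℕ → ℕ) (a j k : ℕ) : ℕ :=
  if k < a then h k 0
  else if k < a + j then v a (k - a)
  else if k = a + j then h a j
  else v (a + 1) (k - a - 1)

theorem frontier_row (v h : ℕ → ℕ → ℕ) {a k : ℕ} (ha : a < n) (hk : k < n) :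
    frontier v h (a + 1) (n - (a + 1)) k = frontier v h a 0 k := by
  rcases lt_trichotomy k a with h1 | rfl | h1
  · simp [frontier, h1, Nat.lt_succ_of_lt h1]
  · simp [frontier]
  · have h2 : ¬ k < a + 1 := by omega
    have h3 : k < a + 1 + (n - (a + 1)) := by omega
    have h4 : ¬ k < a := by omega
    have h5 : k ≠ a := by omega
    simp [frontier, h2, h3, h4, h5, Nat.sub_sub]

theorem frontier_induction {C : ℕ → ℕ → Prop} (start : C 0 n)
    (step : ∀ a j, a + j < n → C a (j + 1) → C a j)
    (row : ∀ a, a < n → C a 0 → C (a + 1) (n - (a + 1))) :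
    ∀ a j, a + j ≤ n → C a j := by
  have inRow : ∀ a, a ≤ n → C a (n - a) → ∀ m j, a + j + m = n → C a j := by
    intro a ha h m
    induction m with
    | zero => intro j hj; rwa [show j = n - a by omega]
    | succ m ih => exact fun j hj => step a j (by omega) (ih (j + 1) (by omega))
  have first : ∀ a, a ≤ n → C a (n - a) := by
    intro a
    induction a with
    | zero => exact fun _ => start
    | succ a ih =>
      exact fun ha => row a ha (inRow a (by omega) (ih (by omega)) (n - a) 0 (by omega))
  exact fun a j h => inRow a (by omega) (first a (by omega)) (n - a - j) j (by omega)

theorem frontier_induction_down {C : ℕ → ℕ → Prop} (start : C n 0)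
    (step : ∀ a j, a + j < n → C a j → C a (j + 1))
    (row : ∀ a, a < n → C (a + 1) (n - (a + 1)) → C a 0) :
    ∀ a j, a + j ≤ n → C a j := by
  have inRow : ∀ a, C a 0 → ∀ j, a + j ≤ n → C a j := by
    intro a h j
    induction j with
    | zero => exact fun _ => h
    | succ j ih => exact fun hj => step a j (by omega) (ih (by omega))
  have first : ∀ m a, a + m = n → C a 0 := by
    intro m
    induction m with
    | zero => rintro a rfl; exact start
    | succ m ih =>
      exact fun a ha => row a (by omega) (inRow _ (ih (a + 1) (by omega)) _ (by omega))
  exact fun a j h => inRow a (first (n - a) a (by omega)) j h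

namespace IsLabelling

variable {P : PD n} {π : Equiv.Perm (Fin n)} {v h : ℕ → ℕ → ℕ}

theorem frontier_start (hL : P.IsLabelling π v h) {k : ℕ} (hk : k < n) :
    frontier v h 0 n k = k := by
  simpa [frontier, hk] using hL.start ⟨k, hk⟩

theorem frontier_end (hL : P.IsLabelling π v h) (k : Fin n) :
    frontier v h n 0 k = π k := by
  simpa [frontier] using hL.exit k

theorem frontier_of_notMem (hL : P.IsLabelling π v h) {a j : Fin n} (hc : (a, j) ∉ P.cross)
    (k : ℕ) : frontier v h a j k = frontier v h a (j + 1) k := by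
  have hcell := hL.cell a j
  rw [if_neg hc] at hcell
  by_cases h1 : k < a
  · simp [frontier, h1]
  rcases lt_trichotomy k (a + j) with h2 | rfl | h2
  · have h3 : k < (a : ℕ) + (j + 1) := by omega
    simp [frontier, h1, h2, h3]
  · simp [frontier, hcell.1]
  · by_cases h3 : k = a + (j + 1)
    · subst h3
      have h5 : ¬ (a : ℕ) + (j + 1) < a := by omega
      simp [frontier, h5, hcell.2]
    · have h4 : ¬ k < (a : ℕ) + j := by omega
      have h5 : ¬ k < (a : ℕ) + (j + 1) := by omega
      have h6 : k ≠ (a : ℕ) + j := by omega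
      simp [frontier, h1, h3, h4, h5, h6]

theorem frontier_of_mem (hL : P.IsLabelling π v h) {a j : Fin n} (hc : (a, j) ∈ P.cross)
    (k : ℕ) : frontier v h a j k =
      frontier v h a (j + 1) (Equiv.swap ((a : ℕ) + j) (a + j + 1) k) := by
  have hcell := hL.cell a j
  rw [if_pos hc] at hcell
  by_cases h1 : k = a + j
  · subst h1
    simp [frontier, hcell.2, add_assoc]
  by_cases h2 : k = a + j + 1
  · subst h2
    have h4 : (a : ℕ) + j + 1 - a - 1 = j := by omega
    have h5 : ¬ (a : ℕ) + j + 1 < a := by omega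
    simp [frontier, h4, h5, hcell.1]
  rw [Equiv.swap_apply_of_ne_of_ne h1 h2]
  have e1 : k < (a : ℕ) + (j + 1) ↔ k < a + j := by omega
  have e2 : k ≠ (a : ℕ) + (j + 1) := by omega
  simp [frontier, e1, e2, h1]

theorem swap_lt {m k : ℕ} (hm : m + 1 < n) (hk : k < n) : Equiv.swap m (m + 1) k < n := by
  rw [Equiv.swap_apply_def]
  split_ifs <;> omega

/-- An adjacent transposition changes the order of the two transposed elements only. -/
theorem swap_lt_swap {m k l : ℕ} (hkl : k < l) (h : ¬ (k = m ∧ l = m + 1)) :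
    Equiv.swap m (m + 1) k < Equiv.swap m (m + 1) l := by
  rw [Equiv.swap_apply_def, Equiv.swap_apply_def]
  split_ifs <;> omega

theorem frontier_bijOn (hL : P.IsLabelling π v h) : ∀ a j, a + j ≤ n →
    (∀ k < n, frontier v h a j k < n) ∧
      ∀ k < n, ∀ l < n, frontier v h a j k = frontier v h a j l → k = l := by
  refine frontier_induction ?_ ?_ ?_
  · exact ⟨fun k hk => by rwa [hL.frontier_start hk],
      fun k hk l hl e => by rwa [hL.frontier_start hk, hL.frontier_start hl] at e⟩
  · rintro a j haj ⟨h1, h2⟩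
    by_cases hc : (⟨a, by omega⟩, ⟨j, by omega⟩) ∈ P.cross
    · have e := hL.frontier_of_mem hc
      have hlt := P.above _ hc
      simp only at e hlt
      simp only [e]
      refine ⟨fun k hk => h1 _ (swap_lt hlt hk), fun k hk l hl hkl => ?_⟩
      exact (Equiv.swap _ _).injective (h2 _ (swap_lt hlt hk) _ (swap_lt hlt hl) hkl)
    · have e := hL.frontier_of_notMem hc
      simp only at e
      simp only [e]
      exact ⟨h1, h2⟩
  · rintro a ha ⟨h1, h2⟩
    refine ⟨fun k hk => ?_, fun k hk l hl hkl => ?_⟩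
    · rw [frontier_row v h ha hk]
      exact h1 k hk
    · rw [frontier_row v h ha hk, frontier_row v h ha hl] at hkl
      exact h2 k hk l hl hkl

/-- An inversion of the labels on the path through `(a, j)` is caused by a cross that lies north-east
of the path. -/
theorem exists_cross_before (hL : P.IsLabelling π v h) : ∀ a j, a + j ≤ n →
    ∀ k l, k < l → l < n → frontier v h a j l ≤ frontier v h a j k →
      ∃ p ∈ P.cross, ((p.1 : ℕ) < a ∨ (p.1 : ℕ) = a ∧ j ≤ p.2) ∧
        s(v p.1 p.2, h p.1 (p.2 + 1)) = s(frontier v h a j k, frontier v h a j l) := by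
  refine frontier_induction ?_ ?_ ?_
  · intro k l hkl hl hle
    rw [hL.frontier_start hl, hL.frontier_start (by omega)] at hle
    omega
  · intro a j haj ih k l hkl hl hle
    by_cases hc : (⟨a, by omega⟩, ⟨j, by omega⟩) ∈ P.cross
    · have e := hL.frontier_of_mem hc
      have hlt := P.above _ hc
      simp only at e hlt
      by_cases h1 : k = a + j ∧ l = a + j + 1
      · obtain ⟨rfl, rfl⟩ := h1
        refine ⟨_, hc, Or.inr ⟨rfl, le_rfl⟩, ?_⟩
        rw [e, e, Equiv.swap_apply_left, Equiv.swap_apply_right, Sym2.eq_swap]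
        simp [frontier, add_assoc]
      · rw [e, e] at hle ⊢
        obtain ⟨p, hp, h2, h3⟩ := ih _ _ (swap_lt_swap hkl h1) (swap_lt hlt hl) hle
        exact ⟨p, hp, by omega, h3⟩
    · have e := hL.frontier_of_notMem hc
      simp only at e
      rw [e, e] at hle ⊢
      obtain ⟨p, hp, h2, h3⟩ := ih _ _ hkl hl hle
      exact ⟨p, hp, by omega, h3⟩
  · intro a ha ih k l hkl hl hle
    rw [frontier_row v h ha hl, frontier_row v h ha (by omega)] at hle ⊢
    obtain ⟨p, hp, h2, h3⟩ := ih _ _ hkl hl hle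
    exact ⟨p, hp, by omega, h3⟩

/-- Two labels on the path through `(a, j)` that leave in the other order meet in a cross that lies
south-west of the path. -/
theorem exists_cross_after (hL : P.IsLabelling π v h) : ∀ a j, a + j ≤ n →
    ∀ k l, k < l → l < n → ∀ x y : Fin n, frontier v h a j k = π x → frontier v h a j l = π y →
      y ≤ x → ∃ p ∈ P.cross, (a < (p.1 : ℕ) ∨ (p.1 : ℕ) = a ∧ p.2 < j) ∧
        s(v p.1 p.2, h p.1 (p.2 + 1)) = s((π x : ℕ), (π y : ℕ)) := by
  refine frontier_induction_down ?_ ?_ ?_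
  · intro k l hkl hl x y hx hy hle
    have h1 := hL.frontier_end ⟨k, by omega⟩
    have h2 := hL.frontier_end ⟨l, hl⟩
    simp only at h1 h2
    rw [h1] at hx
    rw [h2] at hy
    have h3 := congrArg Fin.val (π.injective (Fin.ext hx))
    have h4 := congrArg Fin.val (π.injective (Fin.ext hy))
    simp only at h3 h4
    omega
  · intro a j haj ih k l hkl hl x y hx hy hle
    by_cases hc : (⟨a, by omega⟩, ⟨j, by omega⟩) ∈ P.cross
    · have e := hL.frontier_of_mem hc
      have hlt := P.above _ hc
      simp only at e hlt
      have e' : ∀ k, frontier v h a (j + 1) k =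
          frontier v h a j (Equiv.swap (a + j) (a + j + 1) k) := fun k => by
        rw [e, Equiv.swap_apply_self]
      by_cases h1 : k = a + j ∧ l = a + j + 1
      · obtain ⟨rfl, rfl⟩ := h1
        refine ⟨_, hc, Or.inr ⟨rfl, Nat.lt_succ_self j⟩, ?_⟩
        rw [← hx, ← hy]
        simp [frontier, add_assoc]
      · rw [e'] at hx hy
        obtain ⟨p, hp, h2, h3⟩ := ih _ _ (swap_lt_swap hkl h1) (swap_lt hlt hl) x y hx hy hle
        exact ⟨p, hp, by omega, h3⟩
    · have e := hL.frontier_of_notMem hc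
      simp only at e
      rw [← e] at hx hy
      obtain ⟨p, hp, h2, h3⟩ := ih _ _ hkl hl x y hx hy hle
      exact ⟨p, hp, by omega, h3⟩
  · intro a ha ih k l hkl hl x y hx hy hle
    rw [← frontier_row v h ha (by omega)] at hx hy
    obtain ⟨p, hp, h2, h3⟩ := ih _ _ hkl hl x y hx hy hle
    exact ⟨p, hp, by omega, h3⟩

/-- At each cross of a reduced pipe dream, the horizontal strand has the larger label and leaves
further to the north. -/
theorem inversion_of_mem (hL : P.IsLabelling π v h)
    (hred : ∀ p ∈ P.cross, ∀ q ∈ P.cross,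
      s(v p.1 p.2, h p.1 (p.2 + 1)) = s(v q.1 q.2, h q.1 (q.2 + 1)) → p = q)
    {a j : Fin n} (hc : (a, j) ∈ P.cross) :
    ∃ k l : Fin n, h a (j + 1) = π k ∧ v a j = π l ∧ k < l ∧ π l < π k := by
  have hlt := P.above _ hc
  simp only at hlt
  have e1 : frontier v h a (j + 1) (a + j) = v a j := by simp [frontier]
  have e2 : frontier v h a (j + 1) (a + j + 1) = h a (j + 1) := by
    simp [frontier, add_assoc]
  have e3 : frontier v h a j (a + j) = h a (j + 1) := by
    rw [hL.frontier_of_mem hc, Equiv.swap_apply_left, e2]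
  have e4 : frontier v h a j (a + j + 1) = v a j := by
    rw [hL.frontier_of_mem hc, Equiv.swap_apply_right, e1]
  have b := (hL.frontier_bijOn a j (by omega)).1
  have b1 := b (a + j) (by omega)
  have b2 := b (a + j + 1) (by omega)
  rw [e3] at b1
  rw [e4] at b2
  have k1 : h a (j + 1) = π (π.symm ⟨h a (j + 1), b1⟩) := by simp
  have k2 : v a j = π (π.symm ⟨v a j, b2⟩) := by simp
  refine ⟨_, _, k1, k2, ?_, ?_⟩
  · by_contra hle
    obtain ⟨p, hp, h1, h2⟩ := hL.exists_cross_after a j (by omega) (a + j) (a + j + 1) (by omega)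
      (by omega) _ _ (e3.trans k1) (e4.trans k2) (not_lt.1 hle)
    rw [← k1, ← k2] at h2
    rw [hred _ hp _ hc (h2.trans Sym2.eq_swap)] at h1
    simp only at h1
    omega
  · rw [Fin.lt_def, ← k1, ← k2]
    by_contra hle
    obtain ⟨p, hp, h1, h2⟩ := hL.exists_cross_before a (j + 1) (by omega) (a + j) (a + j + 1)
      (by omega) (by omega) (by rw [e1, e2]; omega)
    rw [e1, e2] at h2
    rw [hred _ hp _ hc h2] at h1
    simp only at h1
    omega

/-- A label of a strand above the antidiagonal in row `a` or below is not one of those that have left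
in the rows before. -/
theorem left_ne_exit (hL : P.IsLabelling π v h) {a j : ℕ} (haj : a + j < n) {k : Fin n}
    (hk : (k : ℕ) < a) : h a j ≠ π k := by
  intro e
  have h1 : frontier v h a j (a + j) = h a j := by simp [frontier]
  have h2 : frontier v h a j k = h k 0 := by simp [frontier, hk]
  have := (hL.frontier_bijOn a j haj.le).2 _ haj _ k.2 (by rw [h1, h2, e, hL.exit])
  omega

theorem top_ne_exit (hL : P.IsLabelling π v h) {a j : ℕ} (haj : a + j < n) {k : Fin n}
    (hk : (k : ℕ) < a) : v a j ≠ π k := by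
  intro e
  have h1 : frontier v h a (j + 1) (a + j) = v a j := by simp [frontier]
  have h2 : frontier v h a (j + 1) k = h k 0 := by simp [frontier, hk]
  have := (hL.frontier_bijOn a (j + 1) haj).2 _ haj _ k.2 (by rw [h1, h2, e, hL.exit])
  omega

end IsLabelling

end PD

/-! ### From reduced pipe dreams to bumpless pipe dreams -/

/-- The tile with the given pipes on its south and its east edge, among the four tiles in which a pipe
meets exactly one of the south and west edges, and exactly one of the north and east edges. -/
def Tile.ofSouthEast (s e : Bool) : Tile :=
  if s then (if e then rElbow else vertical) else (if e then horizontal else jElbow)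

namespace PD

variable {n : ℕ}

/-- `x` is one of the labels `π 0, ..., π d`. -/
def IsBig (π : Equiv.Perm (Fin n)) (d x : ℕ) : Prop :=
  ∃ k : Fin n, (k : ℕ) ≤ d ∧ x = π k

open Classical in
/-- A strand labelled by one of `π 0, ..., π d` runs through the edge `(a, j)` (the top edge of this
cell, if `f` labels top edges, and its left edge, if `f` labels left edges). Only edges above the
antidiagonal count, since the labels of the others are arbitrary. -/
noncomputable def bigEdge (π : Equiv.Perm (Fin n)) (d : ℕ) (f : ℕ → ℕ → ℕ) (a j : ℕ) : Bool :=
  decide (a + j < n ∧ IsBig π d (f a j))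

/-- The tiles of the bumpless pipe dream that belongs to a pipe dream `P` with labels `v` and `h`. Its
rows `0, ..., d` are the reflection of `P`; its vertical edges are the strands of `P` with the labels
`π 0, ..., π d`, and its horizontal edges are the other strands. -/
noncomputable def bpdTile (P : PD n) (π : Equiv.Perm (Fin n)) (d : ℕ) (v h : ℕ → ℕ → ℕ)
    (i j : Fin n) : Tile :=
  open Classical in
  if d < (i : ℕ) then (BPD.rothe π).tile i j
  else if ∃ a : Fin n, (i : ℕ) + a = d ∧ (a, j) ∈ P.cross then Tile.blank
  else Tile.ofSouthEast (bigEdge π d v (d - i) j) (!bigEdge π d h (d - i) (j + 1))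

namespace IsLabelling

variable {P : PD n} {π : Equiv.Perm (Fin n)} {d : ℕ} {v h : ℕ → ℕ → ℕ}

theorem isBig_exit (k : Fin n) : IsBig π d (π k) ↔ (k : ℕ) ≤ d := by
  constructor
  · rintro ⟨l, hl, h⟩
    rwa [π.injective (Fin.ext h)]
  · exact fun hk => ⟨k, hk, rfl⟩

/-- At a cross, the horizontal strand has one of the labels `π 0, ..., π d`, the vertical strand has
not. -/
theorem isBig_of_mem (hL : P.IsLabelling π v h) (hπ : IncreasingAround π d)
    (hred : ∀ p ∈ P.cross, ∀ q ∈ P.cross,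
      s(v p.1 p.2, h p.1 (p.2 + 1)) = s(v q.1 q.2, h q.1 (q.2 + 1)) → p = q)
    {a j : Fin n} (hc : (a, j) ∈ P.cross) : IsBig π d (h a (j + 1)) ∧ ¬ IsBig π d (v a j) := by
  obtain ⟨k, l, hk, hl, hkl, hlt⟩ := hL.inversion_of_mem hred hc
  rw [hk, hl, isBig_exit, isBig_exit]
  constructor
  · by_contra hd
    exact hlt.asymm (hπ.right (not_le.1 hd) hkl)
  · intro hd
    exact hlt.asymm (hπ.left hkl hd)

theorem le_of_mem (hL : P.IsLabelling π v h) (hπ : IncreasingAround π d)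
    (hred : ∀ p ∈ P.cross, ∀ q ∈ P.cross,
      s(v p.1 p.2, h p.1 (p.2 + 1)) = s(v q.1 q.2, h q.1 (q.2 + 1)) → p = q)
    {a j : Fin n} (hc : (a, j) ∈ P.cross) : (a : ℕ) ≤ d := by
  by_contra ha
  obtain ⟨k, hk, e⟩ := (hL.isBig_of_mem hπ hred hc).1
  have := P.above _ hc
  simp only at this
  exact hL.left_ne_exit (a := a) (j := j + 1) (by omega) (k := k) (by omega) e

theorem bpdTile_edges (hL : P.IsLabelling π v h) (hπ : IncreasingAround π d)
    (hred : ∀ p ∈ P.cross, ∀ q ∈ P.cross,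
      s(v p.1 p.2, h p.1 (p.2 + 1)) = s(v q.1 q.2, h q.1 (q.2 + 1)) → p = q)
    (hd : d < n) {i : Fin n} (hi : (i : ℕ) ≤ d) (j : Fin n) :
    (P.bpdTile π d v h i j).north = bigEdge π d v (d - i + 1) j ∧
    (P.bpdTile π d v h i j).south = bigEdge π d v (d - i) j ∧
    (P.bpdTile π d v h i j).west = !bigEdge π d h (d - i) j ∧
    (P.bpdTile π d v h i j).east = !bigEdge π d h (d - i) (j + 1) := by
  obtain ⟨a, ha⟩ : ∃ a : Fin n, (i : ℕ) + a = d := ⟨⟨d - i, by omega⟩, by simp only; omega⟩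
  have hda : d - i = (a : ℕ) := by omega
  have hcell := hL.cell a j
  have hiff : (∃ a : Fin n, (i : ℕ) + a = d ∧ (a, j) ∈ P.cross) ↔ (a, j) ∈ P.cross := by
    constructor
    · rintro ⟨b, hb, hc⟩
      rwa [show a = b from Fin.ext (by omega)]
    · exact fun hc => ⟨a, ha, hc⟩
  rw [bpdTile, if_neg (not_lt.2 hi), hda]
  simp only [hiff]
  split_ifs at hcell ⊢ with hc
  · obtain ⟨h1, h2⟩ := hL.isBig_of_mem hπ hred hc
    have := P.above _ hc
    simp only at this
    have h3 : (a : ℕ) + j < n := by omega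
    have h4 : (a : ℕ) + (j + 1) < n := by omega
    simp [Tile.north, Tile.south, Tile.west, Tile.east, bigEdge, hcell, h1, h2, h3, h4]
  · have e1 : bigEdge π d h a j = bigEdge π d v a j := by rw [bigEdge, bigEdge, hcell.1]
    have e2 : bigEdge π d v (a + 1) j = bigEdge π d h a (j + 1) := by
      rw [bigEdge, bigEdge, hcell.2, add_assoc, add_comm 1 (j : ℕ)]
    rw [e1, e2]
    cases bigEdge π d v a j <;> cases bigEdge π d h a (j + 1) <;>
      simp [Tile.ofSouthEast, Tile.north, Tile.south, Tile.west, Tile.east]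

open Classical in
/-- The bumpless pipe dream that belongs to a reduced pipe dream. -/
noncomputable def toBPD (hL : P.IsLabelling π v h) (hπ : IncreasingAround π d)
    (hred : ∀ p ∈ P.cross, ∀ q ∈ P.cross,
      s(v p.1 p.2, h p.1 (p.2 + 1)) = s(v q.1 q.2, h q.1 (q.2 + 1)) → p = q)
    (hd : 0 < n → d < n) : BPD n where
  tile := P.bpdTile π d v h
  vert i i' j hi := by
    have hdn := hd i.pos
    rcases lt_trichotomy (i : ℕ) d with h1 | h1 | h1
    · rw [(hL.bpdTile_edges hπ hred hdn h1.le j).2.1,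
        (hL.bpdTile_edges hπ hred hdn (i := i') (by omega) j).1]
      congr 1
      omega
    · rw [(hL.bpdTile_edges hπ hred hdn h1.le j).2.1, bpdTile, if_pos (by omega),
        BPD.rothe_north, show d - i = 0 by omega, bigEdge, hL.start, decide_eq_decide]
      have e : IsBig π d j ↔ (π.symm j : ℕ) ≤ d := by
        rw [← isBig_exit (π := π), Equiv.apply_symm_apply]
      rw [e, Fin.lt_def]
      omega
    · rw [bpdTile, if_pos h1, bpdTile, if_pos (by omega)]
      exact (BPD.rothe π).vert i i' j hi
  horiz i j j' hj := by
    rcases le_or_gt (i : ℕ) d with h1 | h1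
    · rw [(hL.bpdTile_edges hπ hred (hd i.pos) h1 j).2.2.2,
        (hL.bpdTile_edges hπ hred (hd i.pos) h1 j').2.2.1, hj]
    · rw [bpdTile, if_pos h1, bpdTile, if_pos h1]
      exact (BPD.rothe π).horiz i j j' hj
  northBorder i j hi := by
    rw [(hL.bpdTile_edges hπ hred (hd i.pos) (by omega) j).1, bigEdge, decide_eq_false_iff_not]
    rintro ⟨h1, k, hk, e⟩
    exact hL.top_ne_exit h1 (by omega) e
  southBorder i j hi := by
    have hdn := hd i.pos
    rcases le_or_gt (i : ℕ) d with h1 | h1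
    · rw [(hL.bpdTile_edges hπ hred hdn h1 j).2.1, bigEdge, show d - i = 0 by omega,
        decide_eq_true_iff, hL.start]
      exact ⟨by omega, π.symm j, by omega, by rw [Equiv.apply_symm_apply]⟩
    · rw [bpdTile, if_pos h1]
      exact (BPD.rothe π).southBorder i j hi
  westBorder i j hj := by
    have hdn := hd i.pos
    rcases le_or_gt (i : ℕ) d with h1 | h1
    · rw [(hL.bpdTile_edges hπ hred hdn h1 j).2.2.1, hj, bigEdge, Bool.not_eq_false',
        decide_eq_true_iff]
      have := hL.exit ⟨d - i, by omega⟩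
      simp only at this
      rw [this, isBig_exit]
      exact ⟨by omega, by simp only; omega⟩
    · rw [bpdTile, if_pos h1]
      exact (BPD.rothe π).westBorder i j hj
  eastBorder i j hj := by
    rcases le_or_gt (i : ℕ) d with h1 | h1
    · rw [(hL.bpdTile_edges hπ hred (hd i.pos) h1 j).2.2.2, hj, bigEdge, Bool.not_eq_true',
        decide_eq_false_iff_not]
      omega
    · rw [bpdTile, if_pos h1]
      exact (BPD.rothe π).eastBorder i j hj

end IsLabelling

theorem IsReducedWithPerm.exists_reflect_eq {P : PD n} {π : Equiv.Perm (Fin n)} {d : ℕ}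
    (hP : P.IsReducedWithPerm π) (hπ : IncreasingAround π d) (hd : 0 < n → d < n) :
    ∃ D : BPD n, D.IsSplit π d ∧ D.reflect d = P := by
  obtain ⟨v, h, h1, h2, h3, hred⟩ := hP
  have hL : P.IsLabelling π v h := ⟨h1, h2, h3⟩
  have hblank : ∀ i j : Fin n, (i : ℕ) ≤ d → ((hL.toBPD hπ hred hd).tile i j = Tile.blank ↔
      ∃ a : Fin n, (i : ℕ) + a = d ∧ (a, j) ∈ P.cross) := by
    intro i j hi
    simp only [IsLabelling.toBPD, bpdTile, if_neg (not_lt.2 hi)]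
    split_ifs with hc
    · simp [hc]
    · simp only [hc, iff_false, Tile.ofSouthEast]
      split_ifs <;> simp
  have hD : (hL.toBPD hπ hred hd).IsSplit π d := by
    constructor
    · intro i j hi
      simp only [IsLabelling.toBPD, bpdTile, if_pos hi]
    · intro i j hi
      simp only [IsLabelling.toBPD, bpdTile, if_neg (not_lt.2 hi), Tile.ofSouthEast]
      split_ifs <;> simp
  refine ⟨_, hD, ?_⟩
  ext ⟨a, j⟩
  rw [hD.mem_reflect hd]
  constructor
  · rintro ⟨i, hi, hb⟩
    rw [BPD.mem_blanks, hblank i j (by omega)] at hb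
    obtain ⟨b, hb, hc⟩ := hb
    rwa [show a = b from Fin.ext (by omega)]
  · intro hc
    have ha := hL.le_of_mem hπ hred hc
    have hdn := hd a.pos
    refine ⟨⟨d - a, by omega⟩, by simp only; omega, ?_⟩
    rw [BPD.mem_blanks, hblank _ j (by simp only; omega)]
    exact ⟨a, by simp only; omega, hc⟩

end PD

/-! ### Droops and slides -/

namespace BPD

variable {n : ℕ}

/-- Replace the tiles in the square with rows `i, i'` and columns `j, j'` by the tiles `a b` (upper row)
and `c e` (lower row), which fit together and have the same edges on the boundary of the square. -/
def replaceSquare (D : BPD n) (i i' j j' : Fin n) (hi : (i' : ℕ) = i + 1) (hj : (j' : ℕ) = j + 1)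
    (a b c e : Tile)
    (ha : a.north = (D.tile i j).north ∧ a.west = (D.tile i j).west)
    (hb : b.north = (D.tile i j').north ∧ b.east = (D.tile i j').east)
    (hc : c.south = (D.tile i' j).south ∧ c.west = (D.tile i' j).west)
    (he : e.south = (D.tile i' j').south ∧ e.east = (D.tile i' j').east)
    (hin : a.south = c.north ∧ b.south = e.north ∧ a.east = b.west ∧ c.east = e.west) : BPD n where
  tile x y :=
    if x = i then (if y = j then a else if y = j' then b else D.tile x y)
    else if x = i' then (if y = j then c else if y = j' then e else D.tile x y)
    else D.tile x y
  vert x x' y hx := by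
    have := D.vert x x' y hx
    grind
  horiz x y y' hy := by
    have := D.horiz x y y' hy
    grind
  northBorder x y hx := by
    have := D.northBorder x y hx
    grind
  southBorder x y hx := by
    have := D.southBorder x y hx
    grind
  westBorder x y hy := by
    have := D.westBorder x y hy
    grind
  eastBorder x y hy := by
    have := D.eastBorder x y hy
    grind

/-- `D'` arises from `D` by a simple droop in the square with rows `i, i'` and columns `j, j'`. -/
def DroopAt (D D' : BPD n) (i i' j j' : Fin n) : Prop :=
  (i' : ℕ) = i + 1 ∧ (j' : ℕ) = j + 1 ∧
    D.tile i j = Tile.rElbow ∧ D'.tile i j = Tile.blank ∧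
    D.tile i' j' = Tile.blank ∧ D'.tile i' j' = Tile.jElbow ∧
    (D.tile i' j = Tile.vertical ∧ D'.tile i' j = Tile.rElbow ∨
      D.tile i' j = Tile.jElbow ∧ D'.tile i' j = Tile.horizontal) ∧
    (D.tile i j' = Tile.horizontal ∧ D'.tile i j' = Tile.rElbow ∨
      D.tile i j' = Tile.jElbow ∧ D'.tile i j' = Tile.vertical) ∧
    ∀ a b : Fin n, ¬ ((a = i ∨ a = i') ∧ (b = j ∨ b = j')) → D'.tile a b = D.tile a b

theorem rothe_ne_jElbow (π : Equiv.Perm (Fin n)) (i j : Fin n) :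
    (rothe π).tile i j ≠ Tile.jElbow := by
  simp only [rothe]
  split_ifs <;> simp

namespace DroopAt

variable {D D' : BPD n} {i i' j j' : Fin n}

theorem simpleDroop (h : DroopAt D D' i i' j j') : SimpleDroop D D' :=
  ⟨i, i', j, j', h⟩

theorem blank_iff (h : DroopAt D D' i i' j j') (a b : Fin n) :
    D.tile a b = Tile.blank ↔
      (a = i' ∧ b = j') ∨ ¬ (a = i ∧ b = j) ∧ D'.tile a b = Tile.blank := by
  obtain ⟨hi, hj, h1, h2, h3, h4, h5, h6, h7⟩ := h
  have hii : i ≠ i' := by rintro rfl; omega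
  have hjj : j ≠ j' := by rintro rfl; omega
  by_cases hab : (a = i ∨ a = i') ∧ (b = j ∨ b = j')
  · obtain ⟨rfl | rfl, rfl | rfl⟩ := hab
    · simp [h1, hii]
    · rcases h6 with h6 | h6 <;> simp [h6, hii, hjj.symm]
    · rcases h5 with h5 | h5 <;> simp [h5, hii.symm, hjj]
    · simp [h3]
  · rw [h7 a b hab]
    have e1 : ¬ (a = i ∧ b = j) := fun h => hab ⟨Or.inl h.1, Or.inl h.2⟩
    have e2 : ¬ (a = i' ∧ b = j') := fun h => hab ⟨Or.inr h.1, Or.inr h.2⟩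
    simp [e1, e2]

variable {π : Equiv.Perm (Fin n)} {d : ℕ}

theorem isSplit_iff_of_le (h : DroopAt D D' i i' j j') (hid : (i' : ℕ) ≤ d) :
    D.IsSplit π d ↔ D'.IsSplit π d := by
  obtain ⟨hi, hj, h1, h2, h3, h4, h5, h6, h7⟩ := h
  have low : ∀ a b : Fin n, d < (a : ℕ) → D'.tile a b = D.tile a b := by
    intro a b ha
    refine h7 a b ?_
    rintro ⟨rfl | rfl, -⟩ <;> omega
  have up : ∀ a b : Fin n, D.tile a b = Tile.cross ↔ D'.tile a b = Tile.cross := by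
    intro a b
    by_cases hab : (a = i ∨ a = i') ∧ (b = j ∨ b = j')
    · obtain ⟨rfl | rfl, rfl | rfl⟩ := hab
      · simp [h1, h2]
      · rcases h6 with h6 | h6 <;> simp [h6]
      · rcases h5 with h5 | h5 <;> simp [h5]
      · simp [h3, h4]
    · rw [h7 a b hab]
  constructor
  · intro hD
    exact ⟨fun a b ha => (low a b ha).trans (hD.lower a b ha),
      fun a b ha hc => hD.upper a b ha ((up a b).2 hc)⟩
  · intro hD
    exact ⟨fun a b ha => (low a b ha).symm.trans (hD.lower a b ha),
      fun a b ha hc => hD.upper a b ha ((up a b).1 hc)⟩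

theorem isSplit (h : DroopAt D D' i i' j j') (hπ : IncreasingAround π d) (hD : D.IsSplit π d) :
    D'.IsSplit π d :=
  (h.isSplit_iff_of_le (hD.le_of_blank hπ h.2.2.2.2.1)).1 hD

theorem isSplit_left (h : DroopAt D D' i i' j j') (hD : D'.IsSplit π d) : D.IsSplit π d := by
  refine (h.isSplit_iff_of_le ?_).2 hD
  by_contra hi
  have h1 := h.2.2.2.2.2.1
  rw [hD.lower _ _ (not_le.1 hi)] at h1
  exact rothe_ne_jElbow _ _ _ h1

theorem reflect_cross (h : DroopAt D D' i i' j j') (hD : D.IsSplit π d) (hD' : D'.IsSplit π d)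
    (hd : 0 < n → d < n) {a a' : Fin n} (ha : (i : ℕ) + a' = d) (ha' : (i' : ℕ) + a = d) :
    (D.reflect d).cross = insert (a, j') ((D'.reflect d).cross.erase (a', j)) := by
  ext ⟨x, y⟩
  rw [Finset.mem_insert, Finset.mem_erase, hD.mem_reflect hd, hD'.mem_reflect hd]
  simp only [mem_blanks, h.blank_iff, Prod.mk.injEq, ne_eq]
  constructor
  · rintro ⟨k, hk, ⟨rfl, rfl⟩ | ⟨h1, h2⟩⟩
    · exact Or.inl ⟨Fin.ext (by omega), rfl⟩
    · refine Or.inr ⟨fun h3 => h1 ⟨Fin.ext ?_, h3.2⟩, k, hk, h2⟩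
      rw [h3.1] at hk
      omega
  · rintro (⟨rfl, rfl⟩ | ⟨h1, k, hk, h2⟩)
    · exact ⟨i', ha', Or.inl ⟨rfl, rfl⟩⟩
    · refine ⟨k, hk, Or.inr ⟨fun h3 => h1 ⟨Fin.ext ?_, h3.2⟩, h2⟩⟩
      rw [h3.1] at hk
      omega

end DroopAt

namespace IsSplit

variable {π : Equiv.Perm (Fin n)} {d : ℕ} {D : BPD n}

theorem exists_droop (hD : D.IsSplit π d) {i i' j j' : Fin n} (hi : (i' : ℕ) = i + 1)
    (hj : (j' : ℕ) = j + 1) (hid : (i' : ℕ) ≤ d) (hSE : D.tile i' j' = Tile.blank)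
    (hSW : D.tile i' j ≠ Tile.blank) (hNE : D.tile i j' ≠ Tile.blank) :
    ∃ D', DroopAt D D' i i' j j' := by
  have v1 := D.vert i i' j hi
  have v2 := D.vert i i' j' hi
  have w1 := D.horiz i j j' hj
  have w2 := D.horiz i' j j' hj
  have c1 := hD.upper i j (by omega)
  have c2 := hD.upper i' j hid
  have c3 := hD.upper i j' (by omega)
  have hsw : D.tile i' j = Tile.vertical ∨ D.tile i' j = Tile.jElbow := by
    rw [hSE] at w2
    cases ht : D.tile i' j <;> simp_all [Tile.east, Tile.west]
  have hne : D.tile i j' = Tile.horizontal ∨ D.tile i j' = Tile.jElbow := by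
    rw [hSE] at v2
    cases ht : D.tile i j' <;> simp_all [Tile.south, Tile.north]
  have hnw : D.tile i j = Tile.rElbow := by
    have s : (D.tile i j).south = true := by
      rw [v1]
      rcases hsw with h | h <;> rw [h] <;> rfl
    have e : (D.tile i j).east = true := by
      rw [w1]
      rcases hne with h | h <;> rw [h] <;> rfl
    revert s e c1
    cases D.tile i j <;> simp [Tile.south, Tile.east]
  refine ⟨D.replaceSquare i i' j j' hi hj Tile.blank
    (if D.tile i j' = Tile.horizontal then Tile.rElbow else Tile.vertical)
    (if D.tile i' j = Tile.vertical then Tile.rElbow else Tile.horizontal) Tile.jElbow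
    (by rw [hnw]; exact ⟨rfl, rfl⟩) ?_ ?_ (by rw [hSE]; exact ⟨rfl, rfl⟩) ?_, ?_⟩
  · rcases hne with h | h <;> rw [h] <;> exact ⟨rfl, rfl⟩
  · rcases hsw with h | h <;> rw [h] <;> exact ⟨rfl, rfl⟩
  · rcases hne with h | h <;> rcases hsw with h' | h' <;> rw [h, h'] <;> exact ⟨rfl, rfl, rfl, rfl⟩
  · have hii : i' ≠ i := by rintro rfl; omega
    have hjj : j' ≠ j := by rintro rfl; omega
    refine ⟨hi, hj, hnw, ?_, hSE, ?_, ?_, ?_, ?_⟩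
    · simp [replaceSquare]
    · simp [replaceSquare, hii, hjj]
    · rcases hsw with h | h <;> simp [replaceSquare, hii, h]
    · rcases hne with h | h <;> simp [replaceSquare, hjj, h]
    · intro a b hab
      simp only [replaceSquare]
      grind

theorem exists_droop_left (hD : D.IsSplit π d) {i i' j j' : Fin n} (hi : (i' : ℕ) = i + 1)
    (hj : (j' : ℕ) = j + 1) (hid : (i' : ℕ) ≤ d) (hNW : D.tile i j = Tile.blank)
    (hSW : D.tile i' j ≠ Tile.blank) (hNE : D.tile i j' ≠ Tile.blank) :
    ∃ D', DroopAt D' D i i' j j' := by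
  have v1 := D.vert i i' j hi
  have v2 := D.vert i i' j' hi
  have w1 := D.horiz i j j' hj
  have w2 := D.horiz i' j j' hj
  have c1 := hD.upper i' j' hid
  have c2 := hD.upper i' j hid
  have c3 := hD.upper i j' (by omega)
  have hsw : D.tile i' j = Tile.rElbow ∨ D.tile i' j = Tile.horizontal := by
    rw [hNW] at v1
    cases ht : D.tile i' j <;> simp_all [Tile.north, Tile.south]
  have hne : D.tile i j' = Tile.rElbow ∨ D.tile i j' = Tile.vertical := by
    rw [hNW] at w1
    cases ht : D.tile i j' <;> simp_all [Tile.east, Tile.west]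
  have hse : D.tile i' j' = Tile.jElbow := by
    have s : (D.tile i' j').north = true := by
      rw [← v2]
      rcases hne with h | h <;> rw [h] <;> rfl
    have e : (D.tile i' j').west = true := by
      rw [← w2]
      rcases hsw with h | h <;> rw [h] <;> rfl
    revert s e c1
    cases D.tile i' j' <;> simp [Tile.north, Tile.west]
  refine ⟨D.replaceSquare i i' j j' hi hj Tile.rElbow
    (if D.tile i j' = Tile.rElbow then Tile.horizontal else Tile.jElbow)
    (if D.tile i' j = Tile.rElbow then Tile.vertical else Tile.jElbow) Tile.blank
    (by rw [hNW]; exact ⟨rfl, rfl⟩) ?_ ?_ (by rw [hse]; exact ⟨rfl, rfl⟩) ?_, ?_⟩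
  · rcases hne with h | h <;> rw [h] <;> exact ⟨rfl, rfl⟩
  · rcases hsw with h | h <;> rw [h] <;> exact ⟨rfl, rfl⟩
  · rcases hne with h | h <;> rcases hsw with h' | h' <;> rw [h, h'] <;> exact ⟨rfl, rfl, rfl, rfl⟩
  · have hii : i' ≠ i := by rintro rfl; omega
    have hjj : j' ≠ j := by rintro rfl; omega
    refine ⟨hi, hj, ?_, hNW, ?_, hse, ?_, ?_, ?_⟩
    · simp [replaceSquare]
    · simp [replaceSquare, hii, hjj]
    · rcases hsw with h | h <;> simp [replaceSquare, hii, h]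
    · rcases hne with h | h <;> simp [replaceSquare, hjj, h]
    · intro a b hab
      simp only [replaceSquare]
      grind

/-- In the upper part there is no crossing, so that the blank tiles determine all others, as soon as the
south and the east edge of each tile are known. -/
theorem eq_of_blank_iff {E : BPD n} (hD : D.IsSplit π d) (hE : E.IsSplit π d)
    (H : ∀ i j : Fin n, (i : ℕ) ≤ d → (D.tile i j = Tile.blank ↔ E.tile i j = Tile.blank)) :
    D = E := by
  refine eq_of_tile_eq fun i j hs he => ?_
  by_cases hi : (i : ℕ) ≤ d
  · have h1 := H i j hi
    have h2 := hD.upper i j hi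
    have h3 := hE.upper i j hi
    revert hs he h1 h2 h3
    cases D.tile i j <;> cases E.tile i j <;> simp [Tile.south, Tile.east]
  · rw [hD.lower i j (not_le.1 hi), hE.lower i j (not_le.1 hi)]

theorem eq_of_reflect_eq {E : BPD n} (hD : D.IsSplit π d) (hE : E.IsSplit π d)
    (hd : 0 < n → d < n) (h : D.reflect d = E.reflect d) : D = E := by
  refine hD.eq_of_blank_iff hE fun i j hi => ?_
  have hdn := hd i.pos
  have e : (i : ℕ) + ((⟨d - i, by omega⟩ : Fin n) : ℕ) = d := by simp only; omega
  rw [← hD.mem_reflect_of_add_eq hd e, ← hE.mem_reflect_of_add_eq hd e, h]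

/-- If `D` is not the Rothe bumpless pipe dream, it contains the result of a simple droop: the square
with the topmost j-elbow in its south-east cell. -/
theorem exists_blank_square_of_ne_rothe (hD : D.IsSplit π d) (hπ : IncreasingAround π d)
    (hne : D ≠ rothe π) : ∃ i i' j j' : Fin n, (i' : ℕ) = i + 1 ∧ (j' : ℕ) = j + 1 ∧
      (i' : ℕ) ≤ d ∧ D.tile i j = Tile.blank ∧ D.tile i' j ≠ Tile.blank ∧
      D.tile i j' ≠ Tile.blank := by
  classical
  have hex : ∃ r : ℕ, ∃ i j : Fin n, (i : ℕ) = r ∧ D.tile i j = Tile.jElbow := by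
    by_contra hno
    push Not at hno
    refine hne (eq_of_tile_eq fun i j hs he => ?_)
    by_cases hi : (i : ℕ) ≤ d
    · have h1 := hno i i j rfl
      have h2 := hD.upper i j hi
      have h3 := rothe_ne_jElbow π i j
      have h4 := (rothe_isSplit hπ).upper i j hi
      revert hs he h1 h2 h3 h4
      cases D.tile i j <;> cases (rothe π).tile i j <;> simp [Tile.south, Tile.east]
    · exact hD.lower i j (not_le.1 hi)
  obtain ⟨i', j', hr, hjE⟩ := Nat.find_spec hex
  have hmin : ∀ i j : Fin n, i < i' → D.tile i j ≠ Tile.jElbow := fun i j hi ht =>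
    Nat.find_min hex (m := i) (by omega) ⟨i, j, rfl, ht⟩
  have hid : (i' : ℕ) ≤ d := by
    by_contra hi
    rw [hD.lower _ _ (not_le.1 hi)] at hjE
    exact rothe_ne_jElbow _ _ _ hjE
  have hi0 : (i' : ℕ) ≠ 0 := fun h0 => by
    have := D.northBorder i' j' h0
    rw [hjE] at this
    cases this
  have hj0 : (j' : ℕ) ≠ 0 := fun h0 => by
    have := D.westBorder i' j' h0
    rw [hjE] at this
    cases this
  obtain ⟨i, hi⟩ : ∃ i : Fin n, (i' : ℕ) = i + 1 := ⟨⟨i' - 1, by omega⟩, by simp only; omega⟩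
  obtain ⟨j, hj⟩ : ∃ j : Fin n, (j' : ℕ) = j + 1 := ⟨⟨j' - 1, by omega⟩, by simp only; omega⟩
  have v1 := D.vert i i' j hi
  have v2 := D.vert i i' j' hi
  have w1 := D.horiz i j j' hj
  have w2 := D.horiz i' j j' hj
  have c1 := hD.upper i' j hid
  have c2 := hD.upper i j' (by omega)
  have m1 := hmin i j (Fin.lt_def.2 (by omega))
  have m2 := hmin i j' (Fin.lt_def.2 (by omega))
  rw [hjE] at v2 w2
  have hsw : D.tile i' j = Tile.rElbow ∨ D.tile i' j = Tile.horizontal := by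
    revert w2 c1
    cases D.tile i' j <;> simp [Tile.east, Tile.west]
  have hne : D.tile i j' = Tile.rElbow ∨ D.tile i j' = Tile.vertical := by
    revert v2 c2 m2
    cases D.tile i j' <;> simp [Tile.south, Tile.north]
  refine ⟨i, i', j, j', hi, hj, hid, ?_, ?_, ?_⟩
  · have s : (D.tile i j).south = false := by
      rw [v1]
      rcases hsw with h | h <;> rw [h] <;> rfl
    have e : (D.tile i j).east = false := by
      rw [w1]
      rcases hne with h | h <;> rw [h] <;> rfl
    revert s e m1
    cases D.tile i j <;> simp [Tile.south, Tile.east]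
  · rcases hsw with h | h <;> simp [h]
  · rcases hne with h | h <;> simp [h]

/-- If the blank tiles of a row are not left-justified, a simple droop is possible: otherwise the
row above would not be left-justified either. -/
theorem exists_droop_of_not_leftJustified (hD : D.IsSplit π d) (m : ℕ) : ∀ {i' j j' : Fin n},
    (i' : ℕ) = m → (j' : ℕ) = j + 1 → (i' : ℕ) ≤ d → D.tile i' j' = Tile.blank →
    D.tile i' j ≠ Tile.blank → ∃ D', SimpleDroop D D' := by
  induction m with
  | zero =>
    intro i' j j' hi hj hid hSE hSW
    have h1 := D.northBorder i' j hi
    have h2 := D.horiz i' j j' hj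
    have h3 := hD.upper i' j hid
    rw [hSE] at h2
    revert h1 h2 h3 hSW
    cases D.tile i' j <;> simp [Tile.north, Tile.east, Tile.west]
  | succ m ih =>
    intro i' j j' hi' hj hid hSE hSW
    obtain ⟨i, hi⟩ : ∃ i : Fin n, (i' : ℕ) = i + 1 := ⟨⟨i' - 1, by omega⟩, by simp only; omega⟩
    by_cases hNE : D.tile i j' = Tile.blank
    · refine ih (i' := i) (j := j) (by omega) hj (by omega) hNE ?_
      have h1 := D.vert i i' j hi
      have h2 := D.horiz i' j j' hj
      have h3 := hD.upper i' j hid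
      intro h4
      rw [hSE] at h2
      rw [h4] at h1
      revert h1 h2 h3 hSW
      cases D.tile i' j <;> simp [Tile.north, Tile.east, Tile.west, Tile.south]
    · obtain ⟨D', h⟩ := hD.exists_droop hi hj hid hSE hSW hNE
      exact ⟨D', h.simpleDroop⟩

theorem of_reflTransGen {D' : BPD n} (hD : D.IsSplit π d) (hπ : IncreasingAround π d)
    (h : ReflTransGen SimpleDroop D D') : D'.IsSplit π d := by
  induction h with
  | refl => exact hD
  | tail _ hs ih =>
    obtain ⟨i, i', j, j', hs⟩ := hs
    exact DroopAt.isSplit hs hπ ih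

theorem simpleSlide_of_simpleDroop {D' : BPD n} (hD : D.IsSplit π d) (hπ : IncreasingAround π d)
    (hd : 0 < n → d < n) (h : SimpleDroop D D') :
    PD.SimpleSlide (D'.reflect d) (D.reflect d) := by
  obtain ⟨i, i', j, j', h⟩ := h
  have h : DroopAt D D' i i' j j' := h
  have hD' := h.isSplit hπ hD
  have hid := hD.le_of_blank hπ h.2.2.2.2.1
  have hdn := hd i.pos
  obtain ⟨a, ha⟩ : ∃ a : Fin n, (i' : ℕ) + a = d := ⟨⟨d - i', by omega⟩, by simp only; omega⟩
  have hi := h.1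
  obtain ⟨a', ha'⟩ : ∃ a' : Fin n, (i : ℕ) + a' = d := ⟨⟨d - i, by omega⟩, by simp only; omega⟩
  refine ⟨a, a', j, j', by omega, h.2.1, ?_, ?_, ?_, ?_, h.reflect_cross hD hD' hd ha' ha⟩
  · rw [hD'.mem_reflect_of_add_eq hd ha']
    exact h.2.2.2.1
  · rw [hD'.mem_reflect_of_add_eq hd ha]
    rcases h.2.2.2.2.2.2.1 with h1 | h1 <;> simp [h1]
  · rw [hD'.mem_reflect_of_add_eq hd ha]
    simp [h.2.2.2.2.2.1]
  · rw [hD'.mem_reflect_of_add_eq hd ha']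
    rcases h.2.2.2.2.2.2.2.1 with h1 | h1 <;> simp [h1]

theorem exists_simpleDroop_of_simpleSlide {P : PD n} (hD : D.IsSplit π d)
    (hd : 0 < n → d < n) (h : PD.SimpleSlide (D.reflect d) P) :
    ∃ D' : BPD n, D'.IsSplit π d ∧ D'.reflect d = P ∧ SimpleDroop D' D := by
  obtain ⟨a, a', j, j', ha, hj, h1, h2, h3, h4, h5⟩ := h
  have hdn := hd a.pos
  obtain ⟨i, hi, hb⟩ := (hD.mem_reflect hd).1 h1
  obtain ⟨i', hi'⟩ : ∃ i' : Fin n, (i' : ℕ) = i + 1 := ⟨⟨i + 1, by omega⟩, rfl⟩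
  have e : (i' : ℕ) + a = d := by omega
  rw [hD.mem_reflect_of_add_eq hd e] at h2 h3
  rw [hD.mem_reflect_of_add_eq hd hi] at h4
  obtain ⟨D', h⟩ := hD.exists_droop_left hi' hj (by omega) (mem_blanks.1 hb) h2 h4
  have hD' := h.isSplit_left hD
  exact ⟨D', hD', PD.ext (by rw [h.reflect_cross hD' hD hd hi e, h5]), h.simpleDroop⟩

theorem reflTransGen_slide {D' : BPD n} (hD : D.IsSplit π d) (hπ : IncreasingAround π d)
    (hd : 0 < n → d < n) (h : ReflTransGen SimpleDroop D D') :
    ReflTransGen PD.SimpleSlide (D'.reflect d) (D.reflect d) := by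
  induction h with
  | refl => exact ReflTransGen.refl
  | tail hs hs' ih =>
    exact ReflTransGen.head ((hD.of_reflTransGen hπ hs).simpleSlide_of_simpleDroop hπ hd hs') ih

theorem exists_reflTransGen_droop {P : PD n} (hD : D.IsSplit π d) (hd : 0 < n → d < n)
    (h : ReflTransGen PD.SimpleSlide (D.reflect d) P) :
    ∃ D' : BPD n, D'.IsSplit π d ∧ D'.reflect d = P ∧ ReflTransGen SimpleDroop D' D := by
  induction h with
  | refl => exact ⟨D, hD, rfl, ReflTransGen.refl⟩
  | tail _ hs ih =>
    obtain ⟨D', hD', rfl, h'⟩ := ih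
    obtain ⟨D'', hD'', h1, h2⟩ := hD'.exists_simpleDroop_of_simpleSlide hd hs
    exact ⟨D'', hD'', h1, ReflTransGen.head h2 h'⟩

theorem reflTransGen_iff {D' : BPD n} (hD : D.IsSplit π d) (hD' : D'.IsSplit π d)
    (hπ : IncreasingAround π d) (hd : 0 < n → d < n) :
    ReflTransGen PD.SimpleSlide (D'.reflect d) (D.reflect d) ↔ ReflTransGen SimpleDroop D D' := by
  refine ⟨fun h => ?_, hD.reflTransGen_slide hπ hd⟩
  obtain ⟨E, hE, h1, h2⟩ := hD'.exists_reflTransGen_droop hd h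
  rwa [← hE.eq_of_reflect_eq hD hd h1]

theorem rothe_reflTransGen {D : BPD n} (hD : D.IsSplit π d) (hπ : IncreasingAround π d)
    (hd : 0 < n → d < n) : ReflTransGen SimpleDroop (rothe π) D := by
  by_cases hne : D = rothe π
  · rw [hne]
  · obtain ⟨i, i', j, j', hi, hj, hid, h1, h2, h3⟩ := hD.exists_blank_square_of_ne_rothe hπ hne
    obtain ⟨E, h⟩ := hD.exists_droop_left hi hj hid h1 h2 h3
    have hE := h.isSplit_left hD
    have hlt := (hE.simpleSlide_of_simpleDroop hπ hd h.simpleDroop).sum_lt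
    exact (rothe_reflTransGen hE hπ hd).tail h.simpleDroop
termination_by ∑ p ∈ (D.reflect d).cross, (p.1 : ℕ)

theorem exists_maximal {D : BPD n} (hD : D.IsSplit π d) (hπ : IncreasingAround π d) :
    ∃ E : BPD n, E.IsSplit π d ∧ ReflTransGen SimpleDroop D E ∧ ∀ E', ¬ SimpleDroop E E' := by
  by_cases h : ∃ D', SimpleDroop D D'
  · obtain ⟨D', h⟩ := h
    have hlt := h.sum_lt
    obtain ⟨E, hE, h1, h2⟩ := (hD.of_reflTransGen hπ (ReflTransGen.single h)).exists_maximal hπ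
    exact ⟨E, hE, ReflTransGen.head h h1, h2⟩
  · exact ⟨D, hD, ReflTransGen.refl, not_exists.1 h⟩
termination_by ∑ p ∈ D.blanks, (p.1 : ℕ)

end IsSplit

end BPD

/-! ### The bottom pipe dream -/

namespace PD

variable {n : ℕ} {P : PD n} {π : Equiv.Perm (Fin n)}

/-- In a left-justified pipe dream the labels above each row increase, row by row the label behind the
last cross leaves, and this label is larger than precisely the labels of the crosses. -/
theorem IsReducedWithPerm.eq_bottom (hP : P.IsReducedWithPerm π)
    (hleft : ∀ a j j' : Fin n, j < j' → (a, j') ∈ P.cross → (a, j) ∈ P.cross) : P = bottom π := by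
  classical
  obtain ⟨v, h, e1, e2, e3, -⟩ := hP
  have hL : P.IsLabelling π v h := ⟨e1, e2, e3⟩
  have hrow : ∀ a : Fin n, ∃ b : ℕ, a + b < n ∧ ∀ j : Fin n, (a, j) ∈ P.cross ↔ (j : ℕ) < b := by
    intro a
    have hex : ∃ b : ℕ, ∃ hb : b < n, (a, (⟨b, hb⟩ : Fin n)) ∉ P.cross := by
      refine ⟨n - 1 - a, by omega, fun hc => ?_⟩
      have := P.above _ hc
      simp only at this
      omega
    obtain ⟨hb, hb'⟩ := Nat.find_spec hex
    have hmin : ∀ j : Fin n, (j : ℕ) < Nat.find hex → (a, j) ∈ P.cross := by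
      intro j hj
      by_contra hc
      exact Nat.find_min hex hj ⟨j.2, hc⟩
    refine ⟨Nat.find hex, ?_, fun j => ⟨fun hc => ?_, hmin j⟩⟩
    · by_contra hlt
      have := P.above _ (hmin ⟨n - 1 - a, by omega⟩ (by simp only; omega))
      simp only at this
      omega
    · by_contra hj
      rcases (not_lt.1 hj).eq_or_lt with h1 | h1
      · exact hb' (by simpa [h1] using hc)
      · exact hb' (hleft a _ j (Fin.lt_def.2 h1) hc)
  choose b hb hmem using hrow
  have hcross : ∀ a j : Fin n, (j : ℕ) < b a → v (a + 1) j = v a j ∧ h a j = h a (j + 1) := by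
    intro a j hj
    have := hL.cell a j
    rwa [if_pos ((hmem a j).2 hj)] at this
  have helbow : ∀ a j : Fin n, b a ≤ j → h a j = v a j ∧ v (a + 1) j = h a (j + 1) := by
    intro a j hj
    have := hL.cell a j
    rwa [if_neg (fun hc => absurd ((hmem a j).1 hc) (not_lt.2 hj))] at this
  have hexit : ∀ a : Fin n, v a (b a) = π a := by
    intro a
    have h1 : ∀ j, j ≤ b a → h a j = h a 0 := by
      intro j
      induction j with
      | zero => exact fun _ => rfl
      | succ j ih =>
        intro hj
        have := hb a
        rw [← ih (by omega), ← (hcross a ⟨j, by omega⟩ hj).2]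
    have := hb a
    have h2 := (helbow a ⟨b a, by omega⟩ le_rfl).1
    simp only at h2
    rw [← h2, h1 _ le_rfl, hL.exit]
  have hmono : ∀ a, a ≤ n → ∀ j k, j < k → a + k < n → v a j < v a k := by
    intro a
    induction a with
    | zero =>
      intro _ j k hjk hk
      have h1 := hL.start ⟨j, by omega⟩
      have h2 := hL.start ⟨k, by omega⟩
      simp only at h1 h2
      omega
    | succ a ih =>
      intro ha j k hjk hk
      have e : ∀ j, a + 1 + j < n →
          v (a + 1) j = v a (if j < b ⟨a, ha⟩ then j else j + 1) := by
        intro j hj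
        split_ifs with hjb
        · exact (hcross ⟨a, ha⟩ ⟨j, by omega⟩ hjb).1
        · have h1 := (helbow ⟨a, ha⟩ ⟨j, by omega⟩ (not_lt.1 hjb)).2
          have h2 := (helbow ⟨a, ha⟩ ⟨j + 1, by omega⟩ (by simp only; omega)).1
          exact h1.trans h2
      rw [e j (by omega), e k hk]
      refine ih (by omega) _ _ ?_ ?_ <;> split_ifs <;> omega
  have hF : ∀ a j : ℕ, a + j < n → PD.frontier v h a (n - a) (a + j) = v a j := by
    intro a j haj
    have h1 : a + j < a + (n - a) := by omega
    simp [frontier, h1]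
  have hlehmer : ∀ a : Fin n, b a = lehmer π a := by
    intro a
    have hba := hb a
    obtain ⟨hlt, hinj⟩ := hL.frontier_bijOn a (n - a) (by omega)
    have hv : ∀ j < b a, v a j < n := by
      intro j hj
      have := hlt (a + j) (by omega)
      rwa [hF a j (by omega)] at this
    rw [lehmer, ← Finset.card_range (b a)]
    refine Finset.card_bij (fun j hj => π.symm ⟨v a j, hv j (Finset.mem_range.1 hj)⟩) ?_ ?_ ?_
    · intro j hj
      rw [Finset.mem_range] at hj
      have h1 := hmono a a.2.le j (b a) hj hba
      rw [hexit] at h1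
      simp only [Finset.mem_filter, Finset.mem_univ, true_and, Equiv.apply_symm_apply, Fin.lt_def]
      refine ⟨?_, h1⟩
      rcases lt_trichotomy (a : ℕ) (π.symm ⟨v a j, hv j hj⟩) with h2 | h2 | h2
      · exact h2
      · rw [← Fin.ext_iff, Equiv.eq_symm_apply] at h2
        rw [h2] at h1
        exact absurd h1 (lt_irrefl _)
      · exact absurd (by simp) (hL.top_ne_exit (a := a) (j := j) (by omega) h2)
    · intro j hj k hk hjk
      rw [Finset.mem_range] at hj hk
      have h1 := congrArg Fin.val (π.symm.injective hjk)
      simp only at h1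
      rcases lt_trichotomy j k with h2 | h2 | h2
      · have := hmono a a.2.le j k h2 (by omega); omega
      · exact h2
      · have := hmono a a.2.le k j h2 (by omega); omega
    · intro k hk
      simp only [Finset.mem_filter, Finset.mem_univ, true_and] at hk
      obtain ⟨hk1, hk2⟩ := hk
      have hsurj : Function.Surjective
          (fun m : Fin n => (⟨frontier v h a (n - a) m, hlt m m.2⟩ : Fin n)) := by
        refine Finite.surjective_of_injective fun x y hxy => ?_
        exact Fin.ext (hinj _ x.2 _ y.2 (congrArg Fin.val hxy))
      obtain ⟨m, hm⟩ := hsurj (π k)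
      have hm := congrArg Fin.val hm
      simp only at hm
      have hma : (a : ℕ) ≤ m := by
        by_contra hlt
        have h1 : frontier v h a (n - a) m = h m 0 := by simp [frontier, not_le.1 hlt]
        rw [h1, hL.exit] at hm
        have := π.injective (Fin.ext hm)
        rw [this] at hlt
        omega
      have hm2 := m.2
      have h1 := hF a (m - a) (by omega)
      rw [show (a : ℕ) + (m - a) = m by omega, hm] at h1
      have hmb : (m : ℕ) - a < b a := by
        by_contra hle
        rcases (not_lt.1 hle).eq_or_lt with h2 | h2
        · rw [← h2, hexit] at h1
          omega
        · have := hmono a a.2.le _ _ h2 (by omega)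
          rw [hexit] at this
          omega
      refine ⟨m - a, Finset.mem_range.2 hmb, ?_⟩
      rw [Equiv.symm_apply_eq]
      exact Fin.ext h1.symm
  ext ⟨a, j⟩
  rw [hmem, hlehmer]
  simp [bottom]

end PD

theorem BPD.IsSplit.exists_droop_bottom {n : ℕ} {π : Equiv.Perm (Fin n)} {d : ℕ} {D : BPD n}
    (hD : D.IsSplit π d) (hπ : IncreasingAround π d) (hd : 0 < n → d < n) :
    ∃ E : BPD n, E.IsSplit π d ∧ ReflTransGen SimpleDroop D E ∧ E.reflect d = PD.bottom π := by
  obtain ⟨E, hE, h1, h2⟩ := hD.exists_maximal hπ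
  refine ⟨E, hE, h1, (hE.reflect_isReducedWithPerm hπ hd).eq_bottom ?_⟩
  intro a j j' hj hc
  obtain ⟨i, hi, hb⟩ := (hE.mem_reflect hd).1 hc
  rw [hE.mem_reflect_of_add_eq hd hi]
  have key : ∀ (m : ℕ) (j : Fin n), (j : ℕ) + m = j' → E.tile i j = Tile.blank := by
    intro m
    induction m with
    | zero =>
      intro j hj
      rw [show j = j' from Fin.ext hj]
      exact BPD.mem_blanks.1 hb
    | succ m ih =>
      intro j hj
      by_contra hne
      obtain ⟨E', h⟩ := hE.exists_droop_of_not_leftJustified i (i' := i) (j := j)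
        (j' := ⟨j + 1, by omega⟩) rfl rfl (by omega) (ih _ (by simp only; omega)) hne
      exact h2 E' h
  exact key (j' - j) j (by omega)

/-! ### The poset isomorphism -/

namespace BPD

variable {n : ℕ} {π : Equiv.Perm (Fin n)} {d : ℕ}

theorem mem_bpdSet_iff (hπ : IncreasingAround π d) (hd : 0 < n → d < n) {D : BPD n} :
    D ∈ bpdSet π ↔ D.IsSplit π d :=
  ⟨fun h => HasPerm.isSplit hπ h, fun h => h.hasPerm hπ hd⟩

theorem mem_droopSet_iff (hπ : IncreasingAround π d) (hd : 0 < n → d < n) {D : BPD n} :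
    D ∈ droopSet π ↔ D.IsSplit π d :=
  ⟨fun h => (rothe_isSplit hπ).of_reflTransGen hπ h, fun h => h.rothe_reflTransGen hπ hd⟩

/-- Without descents, `D` is split at every position. For `d = 0` this leaves only row `0` for blank
tiles. -/
theorem HasPerm.blanks_eq_empty {D : BPD n} (hD : D.HasPerm π) (hπ : ∀ i, ¬ IsDescent π i) :
    D.blanks = ∅ := by
  rw [Finset.eq_empty_iff_forall_notMem]
  rintro ⟨i, j⟩ hb
  rw [mem_blanks] at hb
  have h0 := increasingAround_of_isDescent (d := 0) fun i hi => absurd hi (hπ i)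
  have h1 := increasingAround_of_isDescent (d := n) fun i hi => absurd hi (hπ i)
  have hs := hD.isSplit h0
  have hi : (i : ℕ) = 0 := Nat.le_zero.1 (hs.le_of_blank h0 hb)
  obtain ⟨c, hc, hc'⟩ := D.exists_south_of_east_eq_false (i := i) (j := j) (by rw [hb]; rfl)
  rw [← vEdge_succ, hi, hs.vEdge_succ_iff i.pos] at hc'
  -- The pipe `π 0` enters row `0` to the right of column `j`.
  have hlt : π.symm c < π.symm j := by
    refine lt_of_le_of_ne (Fin.le_def.2 (by omega)) fun e => ?_
    rw [π.symm.injective e] at hc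
    exact lt_irrefl _ hc
  have := h1.left hlt (by omega)
  rw [Equiv.apply_symm_apply, Equiv.apply_symm_apply] at this
  exact this.asymm hc

theorem rothe_reflect_isTopJustified (hπ : IncreasingAround π d) (hd : 0 < n → d < n) :
    ((rothe π).reflect d).IsTopJustified := by
  intro a a' j haa hc
  have hs := rothe_isSplit hπ
  obtain ⟨i', hi', hb⟩ := (hs.mem_reflect hd).1 hc
  rw [mem_blanks] at hb
  have hdn := hd i'.pos
  obtain ⟨i, hi⟩ : ∃ i : Fin n, (i : ℕ) + a = d := ⟨⟨d - a, by omega⟩, by simp only; omega⟩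
  rw [hs.mem_reflect_of_add_eq hd hi]
  have hlt : i' < i := Fin.lt_def.2 (by omega)
  have h1 := rothe_south π i' j
  have h2 := rothe_east π i' j
  rw [hb] at h1 h2
  simp only [Tile.south, Tile.east, false_eq_decide_iff, not_le] at h1 h2
  have h3 := hπ.left hlt (by omega)
  -- In the rows `i', ..., d` the pipes turn in column `π i'` or further to the right, so not in
  -- column `j`.
  have h4 : i < π.symm j := by
    by_contra hle
    have := hπ.left h1 (by omega)
    rw [Equiv.apply_symm_apply] at this
    exact this.asymm h2
  have h5 := rothe_south π i j
  have h6 := rothe_east π i j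
  have h7 := rothe_north π i j
  rw [decide_eq_false (not_le.2 h4)] at h5
  rw [decide_eq_false (not_le.2 (h2.trans h3))] at h6
  rw [decide_eq_false h4.asymm] at h7
  revert h5 h6 h7
  cases (rothe π).tile i j <;> simp [Tile.south, Tile.east, Tile.north]

theorem IsSplit.eq_rothe_of_isTopJustified {D : BPD n} (hD : D.IsSplit π d)
    (hπ : IncreasingAround π d) (hd : 0 < n → d < n) (h : (D.reflect d).IsTopJustified) :
    D = rothe π := by
  by_contra hne
  obtain ⟨i, i', j, j', hi, hj, hid, h1, h2, h3⟩ := hD.exists_blank_square_of_ne_rothe hπ hne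
  have hdn := hd i.pos
  obtain ⟨a, ha⟩ : ∃ a : Fin n, (i : ℕ) + a = d := ⟨⟨d - i, by omega⟩, by simp only; omega⟩
  obtain ⟨a', ha'⟩ : ∃ a' : Fin n, (i' : ℕ) + a' = d := ⟨⟨d - i', by omega⟩, by simp only; omega⟩
  refine h2 ((hD.mem_reflect_of_add_eq hd ha').1 (h a' a j (Fin.lt_def.2 (by omega)) ?_))
  exact (hD.mem_reflect_of_add_eq hd ha).2 h1

/-- The bijection `D ↦ D.reflect d` from `BPD(π)` to the reduced pipe dreams. -/
noncomputable def reflectEquiv (hπ : IncreasingAround π d) (hd : 0 < n → d < n) :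
    bpdSet π ≃ redPDSet π :=
  Equiv.ofBijective
    (fun D => ⟨D.1.reflect d,
      ((mem_bpdSet_iff hπ hd).1 D.2).reflect_isReducedWithPerm hπ hd⟩) <| by
    constructor
    · intro D E h
      exact Subtype.ext (((mem_bpdSet_iff hπ hd).1 D.2).eq_of_reflect_eq
        ((mem_bpdSet_iff hπ hd).1 E.2) hd (congrArg Subtype.val h))
    · rintro ⟨P, hP⟩
      obtain ⟨D, hD, h⟩ := PD.IsReducedWithPerm.exists_reflect_eq hP hπ hd
      exact ⟨⟨D, (mem_bpdSet_iff hπ hd).2 hD⟩, Subtype.ext h⟩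

theorem mem_slideSet_iff (hπ : IncreasingAround π d) (hd : 0 < n → d < n) {P : PD n} :
    P ∈ slideSet π ↔ ∃ D : BPD n, D.IsSplit π d ∧ D.reflect d = P := by
  constructor
  · intro hP
    obtain ⟨E, hE, -, h⟩ := (rothe_isSplit hπ).exists_droop_bottom hπ hd
    have hP : ReflTransGen PD.SimpleSlide (PD.bottom π) P := hP
    rw [← h] at hP
    obtain ⟨D, hD, h1, -⟩ := hE.exists_reflTransGen_droop hd hP
    exact ⟨D, hD, h1⟩
  · rintro ⟨D, hD, rfl⟩
    obtain ⟨E, -, h1, h2⟩ := hD.exists_droop_bottom hπ hd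
    have := hD.reflTransGen_slide hπ hd h1
    rwa [h2] at this

theorem slideSet_eq (hπ : IncreasingAround π d) (hd : 0 < n → d < n) :
    slideSet π = redPDSet π := by
  ext P
  rw [mem_slideSet_iff hπ hd]
  constructor
  · rintro ⟨D, hD, rfl⟩
    exact hD.reflect_isReducedWithPerm hπ hd
  · exact fun hP => PD.IsReducedWithPerm.exists_reflect_eq hP hπ hd

/-- `D ↦ D.reflect d` turns simple droops into inverse simple slides. -/
noncomputable def reflectOrderIso (hπ : IncreasingAround π d) (hd : 0 < n → d < n) :
    Droop π ≃o (Slide π)ᵒᵈ where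
  toEquiv := Equiv.ofBijective
    (fun D => OrderDual.toDual ⟨D.1.reflect d,
      (mem_slideSet_iff hπ hd).2 ⟨D.1, (mem_droopSet_iff hπ hd).1 D.2, rfl⟩⟩) <| by
    constructor
    · intro D E h
      exact Subtype.ext (((mem_droopSet_iff hπ hd).1 D.2).eq_of_reflect_eq
        ((mem_droopSet_iff hπ hd).1 E.2) hd
        (congrArg (fun P : (Slide π)ᵒᵈ => (OrderDual.ofDual P).1) h))
    · intro P
      obtain ⟨D, hD, h⟩ := (mem_slideSet_iff hπ hd).1 (OrderDual.ofDual P).2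
      exact ⟨⟨D, (mem_droopSet_iff hπ hd).2 hD⟩, congrArg OrderDual.toDual (Subtype.ext h)⟩
  map_rel_iff' {D E} := ((mem_droopSet_iff hπ hd).1 D.2).reflTransGen_iff
    ((mem_droopSet_iff hπ hd).1 E.2) hπ hd

theorem rowWeight_eq_of_reflected {D : BPD n} {P : PD n} {d : ℕ}
    (h : ∀ i' j : Fin n, (i', j) ∈ P.cross ↔ ∃ i : Fin n, (i : ℕ) + i' = d ∧ (i, j) ∈ D.blanks)
    {k k' : Fin n} (hk : (k : ℕ) + k' = d) : D.rowWeight k = P.rowWeight k' := by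
  refine Finset.card_bij (fun p _ => (k', p.2)) ?_ ?_ ?_
  · rintro ⟨i, j⟩ hp
    simp only [Finset.mem_filter] at hp ⊢
    obtain ⟨hp, rfl⟩ := hp
    exact ⟨(h _ _).2 ⟨_, hk, hp⟩, trivial⟩
  · rintro ⟨i, j⟩ hp ⟨i', j'⟩ hq e
    simp only [Finset.mem_filter, Prod.mk.injEq, true_and] at hp hq e
    rw [hp.2, hq.2, e]
  · rintro ⟨i, j⟩ hp
    simp only [Finset.mem_filter] at hp
    obtain ⟨hp, rfl⟩ := hp
    obtain ⟨l, hl, hb⟩ := (h _ _).1 hp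
    refine ⟨(l, j), ?_, rfl⟩
    simp only [Finset.mem_filter]
    exact ⟨hb, Fin.ext (by omega)⟩

theorem rowWeight_eq_zero_of_reflected {D : BPD n} {P : PD n} {d : ℕ}
    (hD : ∀ p ∈ D.blanks, (p.1 : ℕ) ≤ d)
    (h : ∀ i' j : Fin n, (i', j) ∈ P.cross ↔ ∃ i : Fin n, (i : ℕ) + i' = d ∧ (i, j) ∈ D.blanks)
    {k : Fin n} (hk : d < (k : ℕ)) : D.rowWeight k = 0 ∧ P.rowWeight k = 0 := by
  constructor
  · rw [rowWeight, Finset.card_eq_zero, Finset.filter_eq_empty_iff]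
    rintro p hp rfl
    exact absurd (hD p hp) (not_le.2 hk)
  · rw [PD.rowWeight, Finset.card_eq_zero, Finset.filter_eq_empty_iff]
    rintro ⟨i, j⟩ hp rfl
    obtain ⟨l, hl, -⟩ := (h _ _).1 hp
    simp only at hk
    omega

end BPD

theorem mainTheorem6 {n : ℕ} (π : Equiv.Perm (Fin n)) (hπ : IsGrassmannian π) :
    droopSet π = bpdSet π ∧ slideSet π = redPDSet π ∧
    ∃ (Φ : bpdSet π ≃ redPDSet π) (Ψ : Droop π ≃o (Slide π)ᵒᵈ),
      -- the poset isomorphism `Ψ` is given by the bijection `Φ`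
      (∀ (D : bpdSet π) (E : Droop π), D.1 = E.1 → (Φ D).1 = (OrderDual.ofDual (Ψ E)).1) ∧
      -- the Rothe bumpless pipe dream is mapped to the unique top-justified element of `PD^red(π)`
      (∀ (D : bpdSet π) (P : redPDSet π), D.1 = BPD.rothe π →
        (P.1.IsTopJustified ↔ P = Φ D)) ∧
      -- for the descent position `d` (any `d`, if there is no descent), `Φ` turns blank tiles into
      -- cross tiles and reflects the rows `0, ..., d` vertically; in particular it reverses the weight
      (∀ d : ℕ, (∀ i : ℕ, IsDescent π i → i = d) → ∀ D : bpdSet π,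
        (∀ p ∈ D.1.blanks, (p.1 : ℕ) ≤ d) ∧
        (∀ i' j : Fin n, (i', j) ∈ (Φ D).1.cross ↔
          ∃ i : Fin n, (i : ℕ) + i' = d ∧ (i, j) ∈ D.1.blanks) ∧
        (∀ k k' : Fin n, (k : ℕ) + k' = d → D.1.rowWeight k = (Φ D).1.rowWeight k') ∧
        (∀ k : Fin n, d < (k : ℕ) → D.1.rowWeight k = 0 ∧ (Φ D).1.rowWeight k = 0)) := by
  obtain ⟨d, hd, hdes⟩ : ∃ d : ℕ, (0 < n → d < n) ∧ ∀ i, IsDescent π i → i = d := by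
    by_cases h : ∃ d, IsDescent π d
    · obtain ⟨d, hd⟩ := h
      exact ⟨d, fun _ => Nat.lt_of_succ_lt hd.1, fun i hi => hπ i d hi hd⟩
    · exact ⟨0, fun h => h, fun i hi => absurd ⟨i, hi⟩ h⟩
  have hinc := increasingAround_of_isDescent hdes
  have hsplit := fun D : bpdSet π => (BPD.mem_bpdSet_iff hinc hd).1 D.2
  refine ⟨?_, BPD.slideSet_eq hinc hd, BPD.reflectEquiv hinc hd, BPD.reflectOrderIso hinc hd,
    ?_, ?_, ?_⟩
  · ext D
    rw [BPD.mem_bpdSet_iff hinc hd, BPD.mem_droopSet_iff hinc hd]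
  · intro D E h
    exact congrArg (fun D => BPD.reflect D d) h
  · intro D P hD
    constructor
    · intro hP
      obtain ⟨E, rfl⟩ := (BPD.reflectEquiv hinc hd).surjective P
      rw [show E = D from Subtype.ext
        (((hsplit E).eq_rothe_of_isTopJustified hinc hd hP).trans hD.symm)]
    · rintro rfl
      have := BPD.rothe_reflect_isTopJustified hinc hd
      rwa [← hD] at this
  · intro d' hd' D
    have hblanks : d' = d ∨ D.1.blanks = ∅ := by
      by_cases h : ∃ i, IsDescent π i
      · obtain ⟨i, hi⟩ := h
        exact Or.inl ((hd' i hi).symm.trans (hdes i hi))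
      · exact Or.inr (BPD.HasPerm.blanks_eq_empty D.2 (not_exists.1 h))
    have h1 : ∀ p ∈ D.1.blanks, (p.1 : ℕ) ≤ d' := by
      intro p hp
      rcases hblanks with rfl | h
      · exact (hsplit D).le_of_blank hinc (BPD.mem_blanks.1 hp)
      · simp [h] at hp
    have h2 : ∀ i' j : Fin n, (i', j) ∈ (BPD.reflectEquiv hinc hd D).1.cross ↔
        ∃ i : Fin n, (i : ℕ) + i' = d' ∧ (i, j) ∈ D.1.blanks := by
      intro i' j
      refine ((hsplit D).mem_reflect hd).trans ?_
      rcases hblanks with rfl | h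
      · rfl
      · simp [h]
    exact ⟨h1, h2, fun k k' => BPD.rowWeight_eq_of_reflected h2,
      fun k => BPD.rowWeight_eq_zero_of_reflected h1 h2⟩
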